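/- A Gallai $k$-coloring of the complete graph $K_N$ is an assignment to each edge of $K_N$ of one of $k$ given colors (not all of which need to occur) such that no triangle is rainbow, that is, has three edges of pairwise distinct colors. For a graph $H$ and an integer $k \ge 1$, let $GR_k(H)$ be the least $N$ such that every Gallai $k$-coloring of $K_N$ contains a monochromatic copy of $H$, that is, a (not necessarily induced) subgraph isomorphic to $H$ all of whose edges have the same color. Let $C_m$ be the cycle on $m$ vertices. Theorem. For every $n \in \{4,5\}$ and every integer $k \ge 1$, $GR_k(C_{2n+1}) = n\cdot 2^k + 1$. That is, $GR_k(C_9) = 4\cdot 2^k+1$ and $GR_k(C_{11}) = 5\cdot 2^k+1$ for all $k \ge 1$. -/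

import Mathlib

open SimpleGraph

/-- A colouring of the edges of the complete graph on `V` is a *Gallai colouring* if it has no
rainbow triangle, i.e. no triangle whose three edges have pairwise distinct colours. -/
def IsGallaiColoring {V K : Type*} (c : TopEdgeLabeling V K) : Prop :=
  ∀ (x y z : V) (hxy : x ≠ y) (hyz : y ≠ z) (hxz : x ≠ z),
    ¬ (c.get x y hxy ≠ c.get y z hyz ∧ c.get y z hyz ≠ c.get x z hxz ∧
        c.get x y hxy ≠ c.get x z hxz)

/-- The coloured complete graph contains a monochromatic copy of `H`: for some colour `i`, the
graph formed by the edges of colour `i` has a (not necessarily induced) subgraph isomorphic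
to `H`. -/
def HasMonochromaticCopy {W V K : Type*} (H : SimpleGraph W) (c : TopEdgeLabeling V K) : Prop :=
  ∃ i : K, H.IsContained (c.labelGraph i)

/-- `N` is the *Gallai-Ramsey number* `GR_k(H)`: the least `N` such that every Gallai colouring of
the edges of the complete graph on `N` vertices with colours from a set of `k` colours (not all of
which have to occur) contains a monochromatic copy of `H`. -/
def IsGallaiRamseyNumber {W : Type*} (k : ℕ) (H : SimpleGraph W) (N : ℕ) : Prop :=
  IsLeast {N : ℕ | ∀ c : TopEdgeLabeling (Fin N) (Fin k),
    IsGallaiColoring c → HasMonochromaticCopy H c} N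

/-!
For a Gallai colouring without a monochromatic cycle on `2 * n + 1` vertices, the upper bound is
the case `W = univ`, `X = ∅` of the following statement, proved by induction on the number of
colours and on the number of vertices (`IsGallaiFamily.bounded`). If the edges inside `W` have
colours in `C`, and for each `i ∈ C` a set `X i` of at most `n` vertices is joined to `W` in colour
`i`, then there are at most `n * 2 ^ #C` vertices altogether. The sets `X i` make the induction
work: when a part `A` of a partition of `W` replaces `W`, the vertices joined to `A` in a colour
`i` are moved into `X i`, and if there are `n` of them while `A` has more than `n` vertices, then
the colour `i` cannot occur inside `A` (`hasCycle_of_bip_edge`), so that a colour is saved.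

By Gallai's structure theorem (`IsGallaiFamily.exists_partition`) `W` has a partition into parts
between which only two colours `R` and `B` occur, one for each pair of parts. Let `A` be a largest
part.

* If all parts are singletons, then `W` is two-coloured, and the bound is a strengthening of the
  theorem of Bondy and Erdős on the two-colour Ramsey number of an odd cycle
  (`hasCycle_of_two_colors`): fewer than `n` vertices may be joined to `W` in each of the colours,
  and `4 * n + 1` vertices altogether still force the cycle. Either there are `n` vertices joined
  to almost all others in `B`, which gives the cycle in `B` or a large set without edges of `B`, or
  a subgraph of `R` has large minimum degree, and then rotating a longest path gives a cycle of `R`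
  on more than `2 * n` vertices or a large complete bipartite graph in `B`. A long monochromatic
  cycle can be shortened to one on `2 * n + 1` or `2 * n + 2` vertices, and in the second case
  there is again a large complete bipartite graph in one colour, which settles the matter
  (`hasCycle_of_bip`).
* If `A` has more than `n` vertices, then the induction hypothesis for `A` and for the sets `P` and
  `Q` of vertices joined to `A` in `R` and in `B` suffices (`PartData.card_le`).
* If `A` has between `2` and `n` vertices, then one of `P` and `Q`, say `P`, has more than `3 * n`
  vertices, counting those joined to `W` in the same colour. As `A` is joined to `P` in `R`, two
  long disjoint paths of `R` in `P` close up to the desired cycle (`hasCycle_of_two_paths`).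
  Without such paths, `R` is very sparse on a large part of `P`, and Dirac's theorem gives the
  cycle in `B`, because parts are small (`hasCycle_of_small_parts`). This is the step that needs `n
  ≤ 5`.

For the lower bound, cut `n * 2 ^ k` consecutive numbers into blocks of `2 * n` numbers, pair up
the blocks, pair up the pairs, and so on, and colour an edge by the first level at which its ends
lie in the same block. The levels form an ultrametric, so there are no rainbow triangles. Level `0`
has components on `2 * n` vertices, and the other levels are bipartite.
-/

set_option linter.unusedSectionVars false

namespace GallaiOddCycle

/-! ### Paths, cycles, and cycles through a complete bipartite graph -/

section

variable {V : Type*} [DecidableEq V] {G : SimpleGraph V}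

/-- `IsPathFrom G a b l`: the list `l` enumerates, without repetition, the vertices of a path of
`G` from `a` to `b`. -/
structure IsPathFrom (G : SimpleGraph V) (a b : V) (l : List V) : Prop where
  nodup : l.Nodup
  chain : l.IsChain G.Adj
  head : l.head? = some a
  last : l.getLast? = some b

/-- `HasCycle G m`: the graph `G` has a path with `m` vertices whose ends are adjacent. For
`3 ≤ m` this is a cycle with `m` vertices. -/
def HasCycle (G : SimpleGraph V) (m : ℕ) : Prop :=
  ∃ a b l, IsPathFrom G a b l ∧ G.Adj b a ∧ l.length = m

namespace IsPathFrom

variable {a b c d : V} {l l' : List V}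

lemma head_mem (h : IsPathFrom G a b l) : a ∈ l := List.mem_of_mem_head? h.head

lemma last_mem (h : IsPathFrom G a b l) : b ∈ l := List.mem_of_getLast? h.last

lemma ne_nil (h : IsPathFrom G a b l) : l ≠ [] := by
  rintro rfl; simpa using h.head

lemma length_pos (h : IsPathFrom G a b l) : 0 < l.length := List.length_pos_iff.2 h.ne_nil

lemma single (a : V) : IsPathFrom G a a [a] := ⟨by simp, by simp, by simp, by simp⟩

lemma append (h : IsPathFrom G a b l) (h' : IsPathFrom G c d l') (hbc : G.Adj b c)
    (hd : l.Disjoint l') : IsPathFrom G a d (l ++ l') where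
  nodup := List.nodup_append'.2 ⟨h.nodup, h'.nodup, hd⟩
  chain := by
    refine List.isChain_append.2 ⟨h.chain, h'.chain, ?_⟩
    intro x hx y hy
    rw [h.last] at hx; rw [h'.head] at hy
    simp only [Option.mem_def, Option.some.injEq] at hx hy
    subst hx hy; exact hbc
  head := by simp [List.head?_append, h.head]
  last := by simp [List.getLast?_append, h'.last]

lemma cons (h : IsPathFrom G a b l) (hca : G.Adj c a) (hc : c ∉ l) :
    IsPathFrom G c b (c :: l) :=
  (single c).append h hca (by simpa using hc)

lemma concat (h : IsPathFrom G a b l) (hbc : G.Adj b c) (hc : c ∉ l) :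
    IsPathFrom G a c (l ++ [c]) :=
  h.append (single c) hbc (by simpa using hc)

lemma reverse (h : IsPathFrom G a b l) : IsPathFrom G b a l.reverse where
  nodup := List.nodup_reverse.2 h.nodup
  chain := by
    rw [List.isChain_reverse]
    exact h.chain.imp fun _ _ h => h.symm
  head := by simp [h.last]
  last := by simp [h.head]

/-- Cutting a path in two at an inner edge. -/
lemma split (h : IsPathFrom G a b l) {k : ℕ} (h0 : 0 < k) (hk : k < l.length) :
    IsPathFrom G a l[k - 1] (l.take k) ∧ IsPathFrom G l[k] b (l.drop k) := by
  refine ⟨⟨h.nodup.sublist (List.take_sublist _ _), h.chain.take k, ?_, ?_⟩,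
    ⟨h.nodup.sublist (List.drop_sublist _ _), h.chain.drop k, ?_, ?_⟩⟩
  · rw [List.head?_take, if_neg h0.ne', h.head]
  · rw [List.getLast?_take, if_neg h0.ne', List.getElem?_eq_getElem (by omega)]; simp
  · simp [List.head?_drop, hk]
  · rw [List.getLast?_drop, if_neg (by omega), h.last]

lemma adj_getElem (h : IsPathFrom G a b l) {k : ℕ} (hk : k + 1 < l.length) :
    G.Adj l[k] l[k + 1] := List.isChain_iff_getElem.1 h.chain k hk

lemma getElem_zero (h : IsPathFrom G a b l) : l[0]'h.length_pos = a := by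
  have := h.head
  rw [List.head?_eq_getElem?, List.getElem?_eq_getElem h.length_pos] at this
  simpa using this

lemma getElem_last (h : IsPathFrom G a b l) :
    l[l.length - 1]'(Nat.sub_lt h.length_pos one_pos) = b := by
  have := h.last
  rw [List.getLast?_eq_getElem?, List.getElem?_eq_getElem (Nat.sub_lt h.length_pos one_pos)] at this
  simpa using this

/-- An initial segment of a path, of any prescribed size. -/
lemma take (h : IsPathFrom G a b l) {k : ℕ} (h0 : 0 < k) (hk : k ≤ l.length) :
    ∃ b', IsPathFrom G a b' (l.take k) := by
  rcases hk.eq_or_lt with rfl | hk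
  · exact ⟨b, by simpa using h⟩
  · exact ⟨_, (h.split h0 hk).1⟩

lemma mono {G' : SimpleGraph V} (h : IsPathFrom G a b l)
    (hG : ∀ x ∈ l, ∀ y ∈ l, G.Adj x y → G'.Adj x y) : IsPathFrom G' a b l :=
  ⟨h.nodup, by
    have := h.chain
    rw [List.isChain_iff_getElem] at this ⊢
    intro i hi
    exact hG _ (List.getElem_mem _) _ (List.getElem_mem _) (this i hi), h.head, h.last⟩

/-- A path can be rotated at a neighbour `l[i]` of its last vertex. -/
lemma rotate (h : IsPathFrom G a b l) {i : ℕ} (hi : i + 1 < l.length) (hb : G.Adj b l[i]) :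
    IsPathFrom G a l[i + 1] (l.take (i + 1) ++ (l.drop (i + 1)).reverse) := by
  obtain ⟨h1, h2⟩ := h.split (k := i + 1) (by omega) hi
  refine h1.append h2.reverse hb.symm ?_
  intro x hx hx'
  exact (List.disjoint_take_drop h.nodup le_rfl) hx (by simpa using hx')

lemma card_le (h : IsPathFrom G a b l) {S : Finset V} (hS : ∀ x ∈ l, x ∈ S) :
    l.length ≤ S.card := by
  rw [← List.toFinset_card_of_nodup h.nodup]
  exact Finset.card_le_card fun x hx => hS x (by simpa using hx)

end IsPathFrom

lemma HasCycle.isContained {m : ℕ} (hm : 3 ≤ m) (h : HasCycle G m) : cycleGraph m ⊑ G := by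
  obtain ⟨a, b, l, hl, hba, rfl⟩ := h
  refine ⟨⟨⟨fun i => l[i], ?_⟩, ?_⟩⟩
  · intro x y hxy
    have key : ∀ x y : Fin l.length, (x - y).val = 1 → G.Adj l[x] l[y] := by
      intro x y hab
      rcases le_or_gt y x with hle | hlt
      · rw [Fin.sub_val_of_le hle] at hab
        have hx : x.val = y.val + 1 := by omega
        have := hl.adj_getElem (k := y.val) (by omega)
        simp only [Fin.getElem_fin, hx]
        exact this.symm
      · rw [Fin.coe_sub_iff_lt.mpr hlt] at hab
        have hx : x.val = 0 := by omega
        have hy : y.val = l.length - 1 := by omega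
        simp only [Fin.getElem_fin, hx, hy, hl.getElem_zero, hl.getElem_last]
        exact hba.symm
    rcases cycleGraph_adj'.mp hxy with hab | hab
    · exact key _ _ hab
    · exact (key _ _ hab).symm
  · intro x y hxy
    exact Fin.ext ((List.Nodup.getElem_inj_iff hl.nodup).1 hxy)

lemma HasCycle.mono {G' : SimpleGraph V} {m : ℕ} (h : HasCycle G m) (hG : G ≤ G') :
    HasCycle G' m := by
  obtain ⟨a, b, l, hl, hba, rfl⟩ := h
  exact ⟨a, b, l, hl.mono fun _ _ _ _ h => hG h, hG hba, rfl⟩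

/-- A path through prescribed vertices `t :: ts` in order, with one vertex of `Y` inserted between
any two consecutive ones, exists if any two of them have sufficiently many common neighbours
in `Y`. -/
lemma exists_interleaved_list (G : SimpleGraph V) [DecidableRel G.Adj] :
    ∀ (ts : List V) (t b : V) (Y : Finset V), (t :: ts).Nodup → (t :: ts).getLast? = some b →
      (∀ x ∈ t :: ts, x ∉ Y) →
      (∀ x ∈ t :: ts, ∀ y ∈ t :: ts, x ≠ y →
        ts.length ≤ (Y.filter fun z => G.Adj x z ∧ G.Adj y z).card) →
      ∃ l, IsPathFrom G t b l ∧ l.length = 2 * ts.length + 1 ∧ ∀ z ∈ l, z ∈ t :: ts ∨ z ∈ Y := by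
  intro ts
  induction ts with
  | nil =>
    intro t b Y _ hb _ _
    simp only [List.getLast?_singleton, Option.some.injEq] at hb
    subst hb
    exact ⟨[t], IsPathFrom.single t, by simp, by simp⟩
  | cons u us ih =>
    intro t b Y hnd hb hY hc
    have hnd' := List.nodup_cons.1 hnd
    have htu : t ≠ u := fun h => hnd'.1 (by simp [h])
    have h1 := hc t (by simp) u (by simp) htu
    obtain ⟨y, hy⟩ : (Y.filter fun z => G.Adj t z ∧ G.Adj u z).Nonempty := by
      rw [← Finset.card_pos]; simp only [List.length_cons] at h1; omega
    simp only [Finset.mem_filter] at hy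
    obtain ⟨l, hl, hlen, hmem⟩ := ih u b (Y.erase y) hnd'.2
      (by simpa using hb)
      (fun x hx hx' => hY x (List.mem_cons_of_mem _ hx) (Finset.mem_of_mem_erase hx'))
      (fun x hx z hz hxz => by
        have := hc x (List.mem_cons_of_mem _ hx) z (List.mem_cons_of_mem _ hz) hxz
        rw [Finset.filter_erase]
        have h2 := Finset.pred_card_le_card_erase (a := y)
          (s := Y.filter fun w => G.Adj x w ∧ G.Adj z w)
        simp only [List.length_cons] at this
        omega)
    have hyl : y ∉ l := by
      intro h
      rcases hmem y h with h | h
      · exact hY y (List.mem_cons_of_mem _ h) hy.1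
      · simp at h
    have htl : t ∉ y :: l := by
      intro h
      rcases List.mem_cons.1 h with h | h
      · exact hY t (by simp) (h ▸ hy.1)
      · rcases hmem t h with h | h
        · exact hnd'.1 h
        · exact hY t (by simp) (Finset.mem_of_mem_erase h)
    refine ⟨t :: y :: l, (hl.cons hy.2.2.symm hyl).cons hy.2.1 htl, by simp [hlen]; ring, ?_⟩
    intro z hz
    simp only [List.mem_cons] at hz
    rcases hz with rfl | rfl | hz
    · simp
    · exact Or.inr hy.1
    · rcases hmem z hz with h | h
      · exact Or.inl (List.mem_cons_of_mem _ h)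
      · exact Or.inr (Finset.mem_of_mem_erase h)

/-- If any two vertices of `T` have at least `|T| - 1` common neighbours in `Y`, then any two
vertices of `T` are joined by a path with `2|T| - 1` vertices that alternates between `T` and
`Y`. -/
lemma exists_interleaved (G : SimpleGraph V) [DecidableRel G.Adj] {T Y : Finset V} {a b : V}
    (ha : a ∈ T) (hb : b ∈ T) (hab : a ≠ b) (hTY : Disjoint T Y)
    (hc : ∀ x ∈ T, ∀ y ∈ T, x ≠ y →
      T.card - 1 ≤ (Y.filter fun z => G.Adj x z ∧ G.Adj y z).card) :
    ∃ l, IsPathFrom G a b l ∧ l.length = 2 * T.card - 1 ∧ ∀ z ∈ l, z ∈ T ∨ z ∈ Y := by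
  classical
  have hb' : b ∈ T.erase a := Finset.mem_erase.2 ⟨hab.symm, hb⟩
  have c1 : ((T.erase a).erase b).card + 2 = T.card := by
    rw [← Finset.card_erase_add_one ha, ← Finset.card_erase_add_one hb']
  have hmem : ∀ x ∈ a :: (((T.erase a).erase b).toList ++ [b]), x ∈ T := by
    intro x hx
    simp only [List.mem_cons, List.mem_append, Finset.mem_toList, Finset.mem_erase,
      List.not_mem_nil, or_false] at hx
    rcases hx with rfl | ⟨_, _, h⟩ | rfl <;> assumption
  obtain ⟨l, hl, hlen, hm⟩ := exists_interleaved_list G (((T.erase a).erase b).toList ++ [b]) a b Y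
    (by
      rw [List.nodup_cons]
      refine ⟨by simp [hab], ?_⟩
      rw [List.nodup_append']
      exact ⟨Finset.nodup_toList _, by simp, by simp⟩)
    (by rw [← List.cons_append, List.getLast?_append]; simp)
    (fun x hx => Finset.disjoint_left.1 hTY (hmem x hx))
    (fun x hx y hy hxy => by
      have := hc x (hmem x hx) y (hmem y hy) hxy
      simp only [List.length_append, Finset.length_toList, List.length_singleton]
      omega)
  refine ⟨l, hl, ?_, fun z hz => (hm z hz).imp_left (hmem z)⟩
  simp only [List.length_append, Finset.length_toList, List.length_singleton] at hlen
  omega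

/-- Complete bipartite version: if every vertex of `T` is adjacent to every vertex of `Y` and
`|T| ≤ |Y| + 1`, the alternating paths of `exists_interleaved` exist. -/
lemma exists_interleaved_complete (G : SimpleGraph V) {T Y : Finset V} {a b : V}
    (ha : a ∈ T) (hb : b ∈ T) (hab : a ≠ b) (hTY : Disjoint T Y)
    (hc : ∀ x ∈ T, ∀ y ∈ Y, G.Adj x y) (hcard : T.card ≤ Y.card + 1) :
    ∃ l, IsPathFrom G a b l ∧ l.length = 2 * T.card - 1 ∧ ∀ z ∈ l, z ∈ T ∨ z ∈ Y := by
  classical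
  refine exists_interleaved G ha hb hab hTY fun x hx y hy _ => ?_
  rw [Finset.filter_true_of_mem fun z hz => ⟨hc x hx z hz, hc y hy z hz⟩]
  omega

/-- A subset of prescribed size containing two given elements. -/
lemma exists_subset_card_of_pair {S : Finset V} {a b : V} (ha : a ∈ S) (hb : b ∈ S) (hab : a ≠ b)
    {m : ℕ} (h2 : 2 ≤ m) (hm : m ≤ S.card) :
    ∃ T ⊆ S, a ∈ T ∧ b ∈ T ∧ T.card = m := by
  obtain ⟨T, h1, h3, h4⟩ := Finset.exists_subsuperset_card_eq (s := {a, b}) (t := S) (n := m)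
    (by intro x hx; simp only [Finset.mem_insert, Finset.mem_singleton] at hx
        rcases hx with rfl | rfl <;> assumption)
    (by rw [Finset.card_pair hab]; exact h2) hm
  exact ⟨T, h3, h1 (by simp), h1 (by simp), h4⟩

/-- A complete bipartite graph with parts of sizes at least `n + 1` and `n`, together with an edge
inside the first part, contains a cycle with `2n + 1` vertices. -/
lemma hasCycle_of_bip_edge {n : ℕ} (hn : 1 ≤ n) {P Q : Finset V} (hPQ : Disjoint P Q)
    (hc : ∀ x ∈ P, ∀ y ∈ Q, G.Adj x y) (hP : n + 1 ≤ P.card) (hQ : n ≤ Q.card)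
    {p p' : V} (hp : p ∈ P) (hp' : p' ∈ P) (h : G.Adj p p') : HasCycle G (2 * n + 1) := by
  obtain ⟨T, hT, h1, h2, h3⟩ := exists_subset_card_of_pair hp hp' h.ne (m := n + 1) (by omega) hP
  obtain ⟨l, hl, hlen, -⟩ := exists_interleaved_complete G h1 h2 h.ne
    (Finset.disjoint_of_subset_left hT hPQ) (fun x hx => hc x (hT hx)) (by omega)
  exact ⟨_, _, l, hl, h.symm, by omega⟩

/-- Two adjacent vertices `y`, `y'` with distinct neighbours `t`, `t'` in a set `T` of `n`
vertices, any two of which have many common neighbours, lie on a cycle with `2n + 1` vertices. -/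
lemma hasCycle_of_edge_between {n : ℕ} [DecidableRel G.Adj] {T Y : Finset V}
    (hT : T.card = n) (hTY : Disjoint T Y) {t t' y y' : V} (ht : t ∈ T) (ht' : t' ∈ T)
    (htt : t ≠ t') (hy : y ∉ T) (hy' : y' ∉ T) (hyY : y ∉ Y) (hyY' : y' ∉ Y)
    (hyy : G.Adj y y') (hty : G.Adj y t) (hty' : G.Adj y' t')
    (hc : ∀ x ∈ T, ∀ z ∈ T, x ≠ z →
      n - 1 ≤ (Y.filter fun w => G.Adj x w ∧ G.Adj z w).card) : HasCycle G (2 * n + 1) := by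
  obtain ⟨l, hl, hlen, hm⟩ := exists_interleaved G ht ht' htt hTY (by simpa [hT] using hc)
  have hyl : y ∉ l := fun h => (hm y h).elim hy hyY
  have hyl' : y' ∉ l := fun h => (hm y' h).elim hy' hyY'
  have h2 : 2 ≤ n := by
    rw [← hT]; exact Finset.one_lt_card.2 ⟨t, ht, t', ht', htt⟩
  refine ⟨y, y', _, (hl.cons hty hyl).concat hty'.symm (by simp [hyl', hyy.ne']), hyy.symm, ?_⟩
  simp [hlen, hT]; omega

/-- Two adjacent vertices `z`, `z'` outside a complete bipartite graph with parts `P`, `Q`, with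
distinct neighbours in `Q`, lie on a cycle with `2n + 1` vertices if `|P| ≥ n - 1`, `|Q| ≥ n`. -/
lemma hasCycle_of_bip_outer_edge {n : ℕ} (hn : 2 ≤ n) {P Q : Finset V} (hPQ : Disjoint P Q)
    (hc : ∀ x ∈ P, ∀ y ∈ Q, G.Adj x y) (hP : n ≤ P.card + 1) (hQ : n ≤ Q.card)
    {q q' z z' : V} (hq : q ∈ Q) (hq' : q' ∈ Q) (hqq : q ≠ q') (hzP : z ∉ P) (hzQ : z ∉ Q)
    (hzP' : z' ∉ P) (hzQ' : z' ∉ Q) (hzz : G.Adj z z') (hzq : G.Adj z q) (hzq' : G.Adj z' q') :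
    HasCycle G (2 * n + 1) := by
  classical
  obtain ⟨T, hT, h1, h2, h3⟩ := exists_subset_card_of_pair hq hq' hqq (m := n) hn hQ
  refine hasCycle_of_edge_between (Y := P) h3 (Finset.disjoint_of_subset_left hT hPQ.symm) h1 h2 hqq
    (fun h => hzQ (hT h)) (fun h => hzQ' (hT h)) hzP hzP' hzz hzq hzq' fun x hx y hy _ => ?_
  rw [Finset.filter_true_of_mem fun z hz => ⟨(hc z hz x (hT hx)).symm, (hc z hz y (hT hy)).symm⟩]
  omega

/-- A vertex `z` adjacent to both sides of a complete bipartite graph with parts of size at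
least `n` lies on a cycle with `2n + 1` vertices. -/
lemma hasCycle_of_bip_apex {n : ℕ} (hn : 2 ≤ n) {P Q : Finset V} (hPQ : Disjoint P Q)
    (hc : ∀ x ∈ P, ∀ y ∈ Q, G.Adj x y) (hP : n ≤ P.card) (hQ : n ≤ Q.card)
    {p q z : V} (hp : p ∈ P) (hq : q ∈ Q) (hzP : z ∉ P) (hzQ : z ∉ Q)
    (hzp : G.Adj z p) (hzq : G.Adj z q) : HasCycle G (2 * n + 1) := by
  obtain ⟨q', hq', hne⟩ := Finset.exists_mem_ne (s := Q) (by omega) q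
  refine hasCycle_of_bip_outer_edge (P := P.erase p) (z := p) (z' := z) hn
    (Finset.disjoint_of_subset_left (Finset.erase_subset _ _) hPQ)
    (fun x hx => hc x (Finset.mem_of_mem_erase hx)) ?_ hQ hq' hq hne (by simp)
    (Finset.disjoint_left.1 hPQ hp) (fun h => hzP (Finset.mem_of_mem_erase h)) hzQ hzp.symm
    (hc p hp q' hq') hzq
  rw [Finset.card_erase_of_mem hp]; omega

end

/-! ### Longest paths and Dirac's theorem -/

section

variable {V : Type*} [DecidableEq V] {G : SimpleGraph V}

/-- Among the paths of `G` inside a nonempty finite set there is a longest one. -/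
lemma exists_longest_path (G : SimpleGraph V) {S : Finset V} (hS : S.Nonempty) :
    ∃ a b l, IsPathFrom G a b l ∧ (∀ x ∈ l, x ∈ S) ∧
      ∀ a' b' l', IsPathFrom G a' b' l' → (∀ x ∈ l', x ∈ S) → l'.length ≤ l.length := by
  classical
  let P : ℕ → Prop := fun m => ∃ a b l, IsPathFrom G a b l ∧ (∀ x ∈ l, x ∈ S) ∧ l.length = m
  obtain ⟨s, hs⟩ := hS
  have h1 : P 1 := ⟨s, s, [s], IsPathFrom.single s, by simpa using hs, rfl⟩
  have hb : ∀ m, P m → m ≤ S.card := by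
    rintro m ⟨a, b, l, hl, hm, rfl⟩
    exact hl.card_le hm
  obtain ⟨a, b, l, hl, hm, hlen⟩ := Nat.findGreatest_spec (hb 1 h1) h1
  refine ⟨a, b, l, hl, hm, fun a' b' l' hl' hm' => ?_⟩
  rw [hlen]
  exact Nat.le_findGreatest (hb _ ⟨a', b', l', hl', hm', rfl⟩) ⟨a', b', l', hl', hm', rfl⟩

/-- The neighbours in `S` of the last vertex of a longest path in `S` lie on the path. -/
lemma mem_of_adj_last {S : Finset V} {a b : V} {l : List V} (hl : IsPathFrom G a b l)
    (hS : ∀ x ∈ l, x ∈ S)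
    (hmax : ∀ a' b' l', IsPathFrom G a' b' l' → (∀ x ∈ l', x ∈ S) → l'.length ≤ l.length)
    {x : V} (hx : x ∈ S) (hbx : G.Adj b x) : x ∈ l := by
  by_contra hxl
  have := hmax _ _ _ (hl.concat hbx hxl) (by
    intro y hy
    rcases List.mem_append.1 hy with h | h
    · exact hS y h
    · rw [List.mem_singleton.1 h]; exact hx)
  simp at this

/-- The neighbours of the last vertex `b` of a path, if they all lie on the path, are counted by
their positions. -/
lemma card_positions {S : Finset V} [DecidableRel G.Adj] {a b : V} {l : List V}
    (hl : IsPathFrom G a b l) (hb : ∀ x ∈ S, G.Adj b x → x ∈ l) :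
    (S.filter (G.Adj b)).card ≤
      ((Finset.range (l.length - 1)).filter fun i => ∃ h : i < l.length, G.Adj b l[i]).card := by
  have : S.filter (G.Adj b) ⊆
      ((Finset.range (l.length - 1)).filter fun i => ∃ h : i < l.length, G.Adj b l[i]).image
        (fun i => l[i]?.getD b) := by
    intro x hx
    obtain ⟨hxS, hbx⟩ := Finset.mem_filter.1 hx
    obtain ⟨i, hi, rfl⟩ := List.getElem_of_mem (hb x hxS hbx)
    refine Finset.mem_image.2 ⟨i, Finset.mem_filter.2 ⟨Finset.mem_range.2 ?_, hi, hbx⟩,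
      by simp [hi]⟩
    by_contra hlt
    obtain rfl : i = l.length - 1 := by omega
    rw [hl.getElem_last] at hbx
    exact hbx.ne rfl
  exact (Finset.card_le_card this).trans Finset.card_image_le

/-- A graph with minimum degree at least `n` inside `S` has a cycle with at least `2n + 1`
vertices in `S`, or else there are at least `n` vertices all of whose neighbours in `S` lie in a
set `M` of at most `2n` vertices. These are the vertices that become the last one when a longest
path is rotated, and `M` consists of the last `2n` vertices of that path. -/
lemma long_cycle_or_sparse_pair [DecidableRel G.Adj] {n : ℕ} {S : Finset V} (hS : S.Nonempty)
    (hdeg : ∀ x ∈ S, n ≤ (S.filter (G.Adj x)).card) :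
    (∃ m, 2 * n + 1 ≤ m ∧ m ≤ S.card ∧ HasCycle G m) ∨
      ∃ T M : Finset V, T ⊆ S ∧ M ⊆ S ∧ T ⊆ M ∧ n ≤ T.card ∧ M.card ≤ 2 * n ∧
        ∀ t ∈ T, ∀ x ∈ S, x ∉ M → ¬ G.Adj t x := by
  obtain ⟨a, b, l, hl, hm, hmax⟩ := exists_longest_path G hS
  by_cases hcyc : ∃ m, 2 * n + 1 ≤ m ∧ m ≤ S.card ∧ HasCycle G m
  · exact Or.inl hcyc
  right
  have hbS : ∀ x ∈ S, G.Adj b x → x ∈ l := fun x hx hbx => mem_of_adj_last hl hm hmax hx hbx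
  set I := (Finset.range (l.length - 1)).filter fun i => ∃ h : i < l.length, G.Adj b l[i] with hI
  have hIn : n ≤ I.card := (hdeg b (hm b hl.last_mem)).trans (card_positions hl hbS)
  -- A chord from the end of a path to an early vertex closes a long cycle.
  have hclose : ∀ (b' : V) (l' : List V), IsPathFrom G a b' l' → l'.length = l.length →
      (∀ x ∈ l', x ∈ S) → ∀ j (hj : j < l'.length), G.Adj b' l'[j] → l.length ≤ j + 2 * n := by
    intro b' l' hl' hlen hm' j hj hadj
    by_contra hlt
    refine hcyc ⟨l'.length - j, by omega, ?_, ?_⟩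
    · have := hl'.card_le hm'; omega
    · rcases Nat.eq_zero_or_pos j with rfl | hj0
      · rw [hl'.getElem_zero] at hadj
        exact ⟨a, b', l', hl', hadj, by simp⟩
      · exact ⟨_, _, _, (hl'.split hj0 hj).2, hadj, by simp⟩
  have hIlt : ∀ i ∈ I, ∃ h : i + 1 < l.length, G.Adj b l[i] ∧ l.length ≤ i + 2 * n := by
    intro i hi
    obtain ⟨hi1, hi2, hi3⟩ := Finset.mem_filter.1 hi
    have := Finset.mem_range.1 hi1
    exact ⟨by omega, hi3, hclose b l hl rfl hm i hi2 hi3⟩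
  refine ⟨I.image fun i => l[i + 1]?.getD b, (l.drop (l.length - 2 * n)).toFinset, ?_, ?_, ?_, ?_,
    ?_, ?_⟩
  · intro x hx
    obtain ⟨i, hi, rfl⟩ := Finset.mem_image.1 hx
    obtain ⟨h1, -⟩ := hIlt i hi
    simp only [List.getElem?_eq_getElem h1, Option.getD_some]
    exact hm _ (List.getElem_mem _)
  · intro x hx
    exact hm x (List.mem_of_mem_drop (List.mem_toFinset.1 hx))
  · intro x hx
    obtain ⟨i, hi, rfl⟩ := Finset.mem_image.1 hx
    obtain ⟨h1, -, h2⟩ := hIlt i hi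
    simp only [List.getElem?_eq_getElem h1, Option.getD_some, List.mem_toFinset]
    rw [List.mem_iff_getElem]
    refine ⟨i + 1 - (l.length - 2 * n), by simp; omega, ?_⟩
    rw [List.getElem_drop]
    congr 1; omega
  · rw [Finset.card_image_of_injOn]
    · exact hIn
    · intro i hi j hj hij
      obtain ⟨h1, -⟩ := hIlt i hi
      obtain ⟨h2, -⟩ := hIlt j hj
      simp only [List.getElem?_eq_getElem h1, List.getElem?_eq_getElem h2, Option.getD_some] at hij
      have := (List.Nodup.getElem_inj_iff hl.nodup).1 hij
      omega
  · refine (List.toFinset_card_le _).trans ?_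
    simp; omega
  · intro t ht x hxS hxM htx
    obtain ⟨i, hi, rfl⟩ := Finset.mem_image.1 ht
    obtain ⟨h1, hbi, h2⟩ := hIlt i hi
    simp only [List.getElem?_eq_getElem h1, Option.getD_some] at htx
    have hr := hl.rotate h1 hbi
    have hrm : ∀ y ∈ l.take (i + 1) ++ (l.drop (i + 1)).reverse, y ∈ S := by
      intro y hy
      rcases List.mem_append.1 hy with h | h
      · exact hm y (List.mem_of_mem_take h)
      · exact hm y (List.mem_of_mem_drop (List.mem_reverse.1 h))
    have hrlen : (l.take (i + 1) ++ (l.drop (i + 1)).reverse).length = l.length := by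
      simp; omega
    have hxr : x ∈ l.take (i + 1) ++ (l.drop (i + 1)).reverse :=
      mem_of_adj_last hr hrm (fun a' b' l' h h' => (hmax a' b' l' h h').trans hrlen.ge) hxS htx
    have hxl : x ∈ l := by
      rcases List.mem_append.1 hxr with h | h
      · exact List.mem_of_mem_take h
      · exact List.mem_of_mem_drop (List.mem_reverse.1 h)
    obtain ⟨j, hj, rfl⟩ := List.getElem_of_mem hxl
    have hjlt : j < l.length - 2 * n := by
      by_contra hge
      refine hxM (List.mem_toFinset.2 (List.mem_iff_getElem.2 ⟨j - (l.length - 2 * n), ?_, ?_⟩))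
      · simp; omega
      · rw [List.getElem_drop]; congr 1; omega
    -- The rotation does not move the vertices before position `i`.
    have hjr : j < (l.take (i + 1) ++ (l.drop (i + 1)).reverse).length := by omega
    have := hclose _ _ hr hrlen hrm j hjr (by
      rw [List.getElem_append_left (by simp; omega), List.getElem_take]; exact htx)
    omega

/-- Dirac's theorem: if every vertex of `S` is adjacent to at least half of the `|S|` vertices,
then `S` carries a Hamiltonian cycle. -/
theorem hasCycle_card_of_dirac [DecidableRel G.Adj] {S : Finset V} (hS : 3 ≤ S.card)
    (hdeg : ∀ x ∈ S, S.card ≤ 2 * (S.filter (G.Adj x)).card) : HasCycle G S.card := by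
  obtain ⟨a, b, l, hl, hm, hmax⟩ := exists_longest_path G (S := S) (Finset.card_pos.1 (by omega))
  have hlS := hl.card_le hm
  have hb := card_positions (S := S) hl fun x hx hbx => mem_of_adj_last hl hm hmax hx hbx
  have hr := hl.reverse
  have hmr : ∀ x ∈ l.reverse, x ∈ S := fun x hx => hm x (List.mem_reverse.1 hx)
  have ha := card_positions (S := S) hr fun x hx hbx => mem_of_adj_last hr hmr
    (fun a' b' l' h h' => (hmax a' b' l' h h').trans (by simp)) hx hbx
  have hdb := hdeg b (hm b hl.last_mem)
  have hda := hdeg a (hm a hl.head_mem)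
  set I := (Finset.range (l.length - 1)).filter fun i => ∃ h : i < l.length, G.Adj b l[i] with hI
  set J := (Finset.range (l.reverse.length - 1)).filter
    fun i => ∃ h : i < l.reverse.length, G.Adj a l.reverse[i] with hJ
  -- `J'` lists the positions before the neighbours of the first vertex.
  let J' := J.image fun i => l.length - 2 - i
  have hJ' : J'.card = J.card := by
    refine Finset.card_image_of_injOn fun i hi j hj hij => ?_
    have h1 := Finset.mem_range.1 (Finset.mem_filter.1 hi).1
    have h2 := Finset.mem_range.1 (Finset.mem_filter.1 hj).1
    simp only [List.length_reverse] at h1 h2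
    have hij : l.length - 2 - i = l.length - 2 - j := hij
    omega
  have hsub : I ∪ J' ⊆ Finset.range (l.length - 1) := by
    intro i hi
    rcases Finset.mem_union.1 hi with h | h
    · exact (Finset.mem_filter.1 h).1
    · obtain ⟨j, hj, rfl⟩ := Finset.mem_image.1 h
      have h1 := Finset.mem_range.1 (Finset.mem_filter.1 hj).1
      simp only [List.length_reverse] at h1
      simp only [Finset.mem_range]; omega
  have hne : (I ∩ J').Nonempty := by
    rw [← Finset.card_pos]
    have h1 := Finset.card_union_add_card_inter I J'
    have h2 := Finset.card_le_card hsub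
    rw [Finset.card_range] at h2
    omega
  obtain ⟨i, hi⟩ := hne
  obtain ⟨hiI, hiJ⟩ := Finset.mem_inter.1 hi
  obtain ⟨hir, hil, hbi⟩ := Finset.mem_filter.1 hiI
  obtain ⟨j, hj, hji⟩ := Finset.mem_image.1 hiJ
  obtain ⟨hjr, hjl, haj⟩ := Finset.mem_filter.1 hj
  rw [Finset.mem_range] at hir hjr
  rw [List.length_reverse] at hjl hjr
  have hi1 : i + 1 < l.length := by omega
  have hai : G.Adj a l[i + 1] := by
    rw [List.getElem_reverse] at haj
    convert haj using 2
    omega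
  have hrot := hl.rotate hi1 hbi
  set L := l.take (i + 1) ++ (l.drop (i + 1)).reverse with hL
  have hLlen : L.length = l.length := by simp [hL]; omega
  have hLS : ∀ y ∈ L, y ∈ S := by
    intro y hy
    rcases List.mem_append.1 hy with h | h
    · exact hm y (List.mem_of_mem_take h)
    · exact hm y (List.mem_of_mem_drop (List.mem_reverse.1 h))
  rcases hlS.eq_or_lt with heq | hlt
  · exact ⟨a, _, L, hrot, hai.symm, by omega⟩
  exfalso
  -- A vertex outside the cycle `L` has a neighbour on it, which yields a longer path.
  have hLcard : L.toFinset.card = l.length := by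
    rw [List.toFinset_card_of_nodup hrot.nodup, hLlen]
  have hLsub : L.toFinset ⊆ S := fun x hx => hLS x (List.mem_toFinset.1 hx)
  obtain ⟨v, hv⟩ : (S \ L.toFinset).Nonempty := by
    rw [← Finset.card_pos, Finset.card_sdiff_of_subset hLsub]; omega
  have hvS := (Finset.mem_sdiff.1 hv).1
  have hvL : v ∉ L := fun h => (Finset.mem_sdiff.1 hv).2 (List.mem_toFinset.2 h)
  obtain ⟨w, hwL, hvw⟩ : ∃ w ∈ L, G.Adj v w := by
    by_contra! hno
    have hsub : S.filter (G.Adj v) ⊆ (S \ L.toFinset).erase v := by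
      intro x hx
      obtain ⟨h1, h2⟩ := Finset.mem_filter.1 hx
      exact Finset.mem_erase.2 ⟨h2.ne', Finset.mem_sdiff.2
        ⟨h1, fun h => hno x (List.mem_toFinset.1 h) h2⟩⟩
    have h1 := Finset.card_le_card hsub
    rw [Finset.card_erase_of_mem hv, Finset.card_sdiff_of_subset hLsub] at h1
    have h2 := hdeg v hvS
    have h3 : J.card ≤ l.length - 1 := by
      refine (Finset.card_filter_le _ _).trans ?_
      simp
    omega
  obtain ⟨j, hj, rfl⟩ := List.getElem_of_mem hwL
  have : ∃ c d l', IsPathFrom G c d l' ∧ (∀ x ∈ l', x ∈ S) ∧ l'.length = l.length + 1 := by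
    rcases Nat.eq_zero_or_pos j with rfl | hj0
    · rw [hrot.getElem_zero] at hvw
      refine ⟨v, _, _, hrot.cons hvw hvL, ?_, by simp [hLlen]⟩
      intro x hx
      rcases List.mem_cons.1 hx with rfl | h
      · exact hvS
      · exact hLS x h
    · obtain ⟨h1, h2⟩ := hrot.split hj0 hj
      have h3 := h2.append h1 hai.symm (List.disjoint_take_drop hrot.nodup le_rfl).symm
      refine ⟨v, _, _, h3.cons hvw ?_, ?_, by simp; omega⟩
      · intro h
        rcases List.mem_append.1 h with h | h
        · exact hvL (List.mem_of_mem_drop h)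
        · exact hvL (List.mem_of_mem_take h)
      · intro x hx
        rcases List.mem_cons.1 hx with rfl | h
        · exact hvS
        · rcases List.mem_append.1 h with h | h
          · exact hLS x (List.mem_of_mem_drop h)
          · exact hLS x (List.mem_of_mem_take h)
  obtain ⟨c, d, l', hl', hm', hlen'⟩ := this
  have := hmax c d l' hl' hm'
  omega

/-- Dirac's theorem for an odd number of vertices, in terms of non-neighbours. -/
lemma hasCycle_of_few_nonadj {n : ℕ} (hn : 1 ≤ n) {U : Finset V} (hU : 2 * n + 1 ≤ U.card)
    (hdeg : ∀ x ∈ U, ∃ D : Finset V, D.card + 1 ≤ n ∧ ∀ y ∈ U, y ≠ x → y ∉ D → G.Adj x y) :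
    HasCycle G (2 * n + 1) := by
  classical
  obtain ⟨S, hSU, hS⟩ := Finset.exists_subset_card_eq hU
  rw [← hS]
  refine hasCycle_card_of_dirac (by omega) fun x hx => ?_
  obtain ⟨D, hD, hadj⟩ := hdeg x (hSU hx)
  have hsub : (S.erase x) \ D ⊆ S.filter (G.Adj x) := by
    intro y hy
    simp only [Finset.mem_sdiff, Finset.mem_erase] at hy
    exact Finset.mem_filter.2 ⟨hy.1.2, hadj y (hSU hy.1.2) hy.1.1 hy.2⟩
  have h1 := Finset.card_le_card hsub
  have h2 := Finset.le_card_sdiff D (S.erase x)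
  rw [Finset.card_erase_of_mem hx] at h2
  omega

/-- Two disjoint paths in a set `U` all of whose vertices are adjacent to `α` further vertices can
be completed to a cycle with `2n + 1` vertices if they have `2n + 3 - 2α` vertices altogether:
besides the two paths the cycle uses the `α` vertices and `α - 2` other vertices of `U`. -/
lemma hasCycle_of_two_paths {n α : ℕ} (hα : 2 ≤ α) (hαn : α ≤ n) {A U : Finset V}
    (hAU : Disjoint A U) (hc : ∀ x ∈ A, ∀ y ∈ U, G.Adj x y) (hA : α ≤ A.card)
    (hU : 2 * n + 1 ≤ U.card) {a b c d : V} {l l' : List V} (hl : IsPathFrom G a b l)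
    (hl' : IsPathFrom G c d l') (hlU : ∀ x ∈ l, x ∈ U) (hlU' : ∀ x ∈ l', x ∈ U)
    (hd : l.Disjoint l') (hlen : 2 * n + 3 ≤ l.length + l'.length + 2 * α) :
    HasCycle G (2 * n + 1) := by
  have hp := hl.length_pos
  have hp' := hl'.length_pos
  -- Cut the two paths down to the exact total size.
  obtain ⟨k, k', hk0, hk, hk0', hk', hkk⟩ : ∃ k k', 0 < k ∧ k ≤ l.length ∧ 0 < k' ∧
      k' ≤ l'.length ∧ k + k' + 2 * α = 2 * n + 3 := by
    rcases le_total l.length (2 * n + 2 - 2 * α) with h | h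
    · exact ⟨l.length, 2 * n + 3 - 2 * α - l.length, by omega, le_rfl, by omega, by omega, by omega⟩
    · exact ⟨2 * n + 2 - 2 * α, 1, by omega, by omega, by omega, by omega, by omega⟩
  obtain ⟨b₁, h1⟩ := hl.take hk0 hk
  obtain ⟨d₁, h2⟩ := hl'.take hk0' hk'
  have hm1 : ∀ x ∈ l.take k, x ∈ U := fun x hx => hlU x (List.mem_of_mem_take hx)
  have hm2 : ∀ x ∈ l'.take k', x ∈ U := fun x hx => hlU' x (List.mem_of_mem_take hx)
  have hd12 : (l.take k).Disjoint (l'.take k') := fun x hx hx' =>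
    hd (List.mem_of_mem_take hx) (List.mem_of_mem_take hx')
  obtain ⟨A', hA', hA'c⟩ := Finset.exists_subset_card_eq hA
  obtain ⟨u, hu⟩ : A'.Nonempty := Finset.card_pos.1 (by omega)
  have hec : (A'.erase u).card = α - 1 := by rw [Finset.card_erase_of_mem hu, hA'c]
  rcases hts : (A'.erase u).toList with _ | ⟨t, ts⟩
  · have := congrArg List.length hts
    simp only [Finset.length_toList, List.length_nil] at this
    omega
  have htslen : ts.length + 2 = α := by
    have := congrArg List.length hts
    simp only [Finset.length_toList, List.length_cons] at this
    omega
  have htsmem : ∀ x ∈ t :: ts, x ∈ A' ∧ x ≠ u := by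
    intro x hx
    rw [← hts, Finset.mem_toList, Finset.mem_erase] at hx
    exact hx.symm
  obtain ⟨e, he⟩ : ∃ e, (t :: ts).getLast? = some e :=
    ⟨_, List.getLast?_eq_getLast_of_ne_nil (by simp)⟩
  have heA : e ∈ A' ∧ e ≠ u := htsmem e (List.mem_of_getLast? he)
  set Y := U \ ((l.take k).toFinset ∪ (l'.take k').toFinset) with hY
  classical
  have hYc : α - 2 ≤ Y.card := by
    have h3 := Finset.le_card_sdiff ((l.take k).toFinset ∪ (l'.take k').toFinset) U
    have h4 := Finset.card_union_le (l.take k).toFinset (l'.take k').toFinset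
    have h5 := List.toFinset_card_le (l.take k)
    have h6 := List.toFinset_card_le (l'.take k')
    simp only [List.length_take] at h5 h6
    rw [← hY] at h3
    omega
  have hYU : Y ⊆ U := Finset.sdiff_subset
  obtain ⟨q, hq, hqlen, hqm⟩ := exists_interleaved_list G ts t e Y
    (hts ▸ Finset.nodup_toList _) he
    (fun x hx h => Finset.disjoint_left.1 hAU (hA' (htsmem x hx).1) (hYU h))
    (fun x hx y hy _ => by
      rw [Finset.filter_true_of_mem fun z hz =>
        ⟨hc x (hA' (htsmem x hx).1) z (hYU hz), hc y (hA' (htsmem y hy).1) z (hYU hz)⟩]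
      omega)
  have hAnU : ∀ {x}, x ∈ A' → x ∉ U := fun hx h => Finset.disjoint_left.1 hAU (hA' hx) h
  have hqd : ∀ x ∈ q, x ∉ l.take k ∧ x ∉ l'.take k' ∧ x ≠ u := by
    intro x hx
    rcases hqm x hx with h | h
    · have := htsmem x h
      exact ⟨fun h => hAnU this.1 (hm1 x h), fun h => hAnU this.1 (hm2 x h), this.2⟩
    · have h3 := (Finset.mem_sdiff.1 h)
      simp only [Finset.mem_union, List.mem_toFinset, not_or] at h3
      refine ⟨h3.2.1, h3.2.2, ?_⟩
      rintro rfl; exact hAnU hu h3.1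
  have htA := (htsmem t (by simp)).1
  have hb1U := hm1 b₁ h1.last_mem
  have hcU := hm2 c h2.head_mem
  have hd1U := hm2 d₁ h2.last_mem
  have haU := hm1 a h1.head_mem
  have p1 := h1.append hq (hc t (hA' htA) b₁ hb1U).symm (fun x hx hx' => (hqd x hx').1 hx)
  have p2 := p1.append h2 (hc e (hA' heA.1) c hcU) (by
    intro x hx hx'
    rcases List.mem_append.1 hx with h | h
    · exact hd12 h hx'
    · exact (hqd x h).2.1 hx')
  have p3 := p2.concat (hc u (hA' hu) d₁ hd1U).symm (by
    intro h
    rcases List.mem_append.1 h with h | h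
    · rcases List.mem_append.1 h with h | h
      · exact hAnU hu (hm1 u h)
      · exact (hqd u h).2.2 rfl
    · exact hAnU hu (hm2 u h))
  refine ⟨_, _, _, p3, hc u (hA' hu) a haU, ?_⟩
  simp [hqlen]
  omega

end

/-! ### Long monochromatic cycles in two-coloured complete graphs -/

section

variable {V : Type*} [DecidableEq V] {G R B : SimpleGraph V}

/-- A periodic enumeration of a cycle with `L` vertices: `w i = w j` exactly if `i` and `j` are
congruent modulo `L`, and consecutive vertices are adjacent. -/
structure IsCyclicEnum (G : SimpleGraph V) (L : ℕ) (w : ℕ → V) : Prop where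
  inj : ∀ i j, w i = w j ↔ i ≡ j [MOD L]
  adj : ∀ i, G.Adj (w i) (w (i + 1))

lemma HasCycle.exists_enum {L : ℕ} (h : HasCycle G L) : ∃ w, IsCyclicEnum G L w := by
  obtain ⟨a, b, l, hl, hba, rfl⟩ := h
  have hpos := hl.length_pos
  have hlt : ∀ i, i % l.length < l.length := fun i => Nat.mod_lt _ hpos
  refine ⟨fun i => l[i % l.length]'(hlt i), fun i j => hl.nodup.getElem_inj_iff, fun i => ?_⟩
  by_cases h : i % l.length + 1 < l.length
  · have h1 : (i + 1) % l.length = i % l.length + 1 := by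
      rw [← Nat.mod_add_mod, Nat.mod_eq_of_lt h]
    simp only [h1]
    exact hl.adj_getElem h
  · have h1 : i % l.length = l.length - 1 := by have := hlt i; omega
    have h2 : (i + 1) % l.length = 0 := by
      rw [← Nat.mod_add_mod, h1, Nat.sub_add_cancel hpos, Nat.mod_self]
    simp only [h1, h2, hl.getElem_zero, hl.getElem_last]
    exact hba

namespace IsCyclicEnum

variable {L : ℕ} {w : ℕ → V}

lemma shift (h : IsCyclicEnum G L w) (i : ℕ) : IsCyclicEnum G L (fun j => w (i + j)) :=
  ⟨fun j k => by rw [h.inj]; exact ⟨Nat.ModEq.add_left_cancel' i, Nat.ModEq.add_left i⟩,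
    fun j => h.adj (i + j)⟩

lemma add_period (h : IsCyclicEnum G L w) (i : ℕ) : w (i + L) = w i := by
  rw [h.inj]; simp [Nat.ModEq]

/-- The vertices `w s, w (s + d), …, w (s + d * k)` of an enumerated cycle, as a path of a graph
that contains the chords joining vertices at distance `d`. -/
lemma path_step (h : IsCyclicEnum G L w) {s d k : ℕ} (hd : 0 < d) (hk : d * k < L)
    (hB : ∀ j < k, B.Adj (w (s + d * j)) (w (s + d * j + d))) :
    IsPathFrom B (w s) (w (s + d * k)) ((List.range (k + 1)).map fun j => w (s + d * j)) where
  nodup := by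
    refine List.Nodup.map_on ?_ List.nodup_range
    intro i hi j hj hij
    rw [List.mem_range] at hi hj
    rw [h.inj] at hij
    have h1 : d * i ≤ d * k := Nat.mul_le_mul_left d (by omega)
    have h2 : d * j ≤ d * k := Nat.mul_le_mul_left d (by omega)
    have h3 := Nat.ModEq.eq_of_lt_of_lt (Nat.ModEq.add_left_cancel' s hij) (by omega) (by omega)
    exact Nat.eq_of_mul_eq_mul_left hd h3
  chain := by
    rw [List.isChain_iff_getElem]
    intro i hi
    simp only [List.length_map, List.length_range] at hi
    simp only [List.getElem_map, List.getElem_range]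
    have := hB i (by omega)
    rwa [add_assoc, ← mul_add_one] at this
  head := by rw [List.range_succ_eq_map]; simp
  last := by rw [List.range_succ]; simp

lemma mem_path_step {s d k : ℕ} {x : V}
    (hx : x ∈ (List.range (k + 1)).map fun j => w (s + d * j)) : ∃ j ≤ k, x = w (s + d * j) := by
  obtain ⟨j, hj, rfl⟩ := List.mem_map.1 hx
  exact ⟨j, by rw [List.mem_range] at hj; omega, rfl⟩

/-- An arc of the cycle itself. -/
lemma arc (h : IsCyclicEnum G L w) (s : ℕ) {k : ℕ} (hk : k < L) :
    IsPathFrom G (w s) (w (s + k)) ((List.range (k + 1)).map fun j => w (s + 1 * j)) := by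
  simpa using h.path_step (s := s) (d := 1) (k := k) (B := G) one_pos (by omega)
    fun j _ => by simpa using h.adj (s + j)

/-- A chord that skips `d - 1` vertices of the cycle shortens it by `d - 1`. -/
lemma hasCycle_of_chord (h : IsCyclicEnum G L w) {i d : ℕ} (hd : 1 ≤ d) (hdL : d < L)
    (hc : G.Adj (w i) (w (i + d))) : HasCycle G (L - d + 1) := by
  refine ⟨_, _, _, h.arc (i + d) (k := L - d) (by omega), ?_, by simp⟩
  rw [show i + d + (L - d) = i + L by omega, h.add_period]
  exact hc

/-- If all chords of a cycle with `L` vertices that skip one or two vertices belong to `B`, then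
`B` has a cycle with `L - 2` vertices. It runs through even positions upwards and returns through
odd ones. -/
lemma hasCycle_of_short_chords (h : IsCyclicEnum G L w) (hL : 7 ≤ L)
    (h2 : ∀ i, B.Adj (w i) (w (i + 2))) (h3 : ∀ i, B.Adj (w i) (w (i + 3))) :
    HasCycle B (L - 2) := by
  have main : ∀ m m', 2 * m < L → 2 * m' + 3 < L →
      (2 * m' + 3 = 2 * m + 3 ∨ 2 * m = 2 * m' + 3 + 3) → m + m' + 4 = L → HasCycle B (L - 2) := by
    intro m m' hm hm' hmm hsum
    have p1 := h.path_step (s := 0) (d := 2) (k := m) (B := B) two_pos hm (fun j _ => h2 _)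
    have p2 := h.path_step (s := 3) (d := 2) (k := m') (B := B) two_pos (by omega) (fun j _ => h2 _)
    have p3 := p1.append p2.reverse ?_ ?_
    · refine ⟨_, _, _, p3, ?_, by simp; omega⟩
      have := (h3 0).symm
      simpa using this
    · rcases hmm with e | e
      · have := h3 (0 + 2 * m)
        rwa [show 0 + 2 * m + 3 = 3 + 2 * m' by omega] at this
      · have := (h3 (3 + 2 * m')).symm
        rwa [show 3 + 2 * m' + 3 = 0 + 2 * m by omega] at this
    · intro x hx hx'
      obtain ⟨j, hj, rfl⟩ := mem_path_step hx
      obtain ⟨k, hk, hjk⟩ := mem_path_step (List.mem_reverse.1 hx')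
      rw [h.inj] at hjk
      have := Nat.ModEq.eq_of_lt_of_lt hjk (by omega) (by omega)
      omega
  rcases Nat.even_or_odd' L with ⟨ℓ, rfl | rfl⟩
  · exact main (ℓ - 2) (ℓ - 2) (by omega) (by omega) (by omega) (by omega)
  · exact main ℓ (ℓ - 3) (by omega) (by omega) (by omega) (by omega)

end IsCyclicEnum

/-- The edges of `G` with both ends in `S`. -/
def within (G : SimpleGraph V) (S : Finset V) : SimpleGraph V where
  Adj x y := G.Adj x y ∧ x ∈ S ∧ y ∈ S
  symm := ⟨fun _ _ h => ⟨h.1.symm, h.2.2, h.2.1⟩⟩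
  loopless := ⟨fun _ h => h.1.ne rfl⟩

lemma within_le (G : SimpleGraph V) (S : Finset V) : within G S ≤ G := fun _ _ h => h.1

lemma IsCyclicEnum.mem {S : Finset V} {L : ℕ} {w : ℕ → V} (h : IsCyclicEnum (within G S) L w)
    (i : ℕ) : w i ∈ S := (h.adj i).2.1

lemma IsCyclicEnum.ne {L : ℕ} {w : ℕ → V} (h : IsCyclicEnum G L w) {d : ℕ} (hd : 0 < d)
    (hdL : d < L) (i : ℕ) : w i ≠ w (i + d) := by
  intro heq
  rw [h.inj] at heq
  have h1 : i + 0 ≡ i + d [MOD L] := heq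
  have h2 := Nat.ModEq.eq_of_lt_of_lt (Nat.ModEq.add_left_cancel' i h1) (by omega) hdL
  omega

/-- In a complete graph on `W` covered by two graphs, a monochromatic cycle of length at
least `m ≥ 5` yields one of length `m` or `m + 1`. -/
lemma descend_cycle {W : Finset V} {m : ℕ} (hm : 5 ≤ m) : ∀ (L : ℕ) (R B : SimpleGraph V),
    (∀ x ∈ W, ∀ y ∈ W, x ≠ y → R.Adj x y ∨ B.Adj x y) → m ≤ L → HasCycle (within R W) L →
      HasCycle (within R W) m ∨ HasCycle (within B W) m ∨
        HasCycle (within R W) (m + 1) ∨ HasCycle (within B W) (m + 1) := by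
  intro L
  induction L using Nat.strong_induction_on with
  | _ L ih =>
  intro R B hW hmL hc
  by_cases h1 : L ≤ m + 1
  · rcases (show L = m ∨ L = m + 1 by omega) with rfl | rfl
    · exact Or.inl hc
    · exact Or.inr (Or.inr (Or.inl hc))
  obtain ⟨w, hw⟩ := hc.exists_enum
  by_cases h2 : ∃ i, R.Adj (w i) (w (i + 2))
  · obtain ⟨i, hi⟩ := h2
    have := hw.hasCycle_of_chord (d := 2) (by omega) (by omega) ⟨hi, hw.mem _, hw.mem _⟩
    exact ih (L - 2 + 1) (by omega) R B hW (by omega) this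
  by_cases h3 : ∃ i, R.Adj (w i) (w (i + 3))
  · obtain ⟨i, hi⟩ := h3
    have := hw.hasCycle_of_chord (d := 3) (by omega) (by omega) ⟨hi, hw.mem _, hw.mem _⟩
    exact ih (L - 3 + 1) (by omega) R B hW (by omega) this
  push Not at h2 h3
  have := hw.hasCycle_of_short_chords (B := within B W) (by omega)
    (fun i => ⟨(hW _ (hw.mem _) _ (hw.mem _) (hw.ne two_pos (by omega) i)).resolve_left (h2 i),
      hw.mem _, hw.mem _⟩)
    (fun i => ⟨(hW _ (hw.mem _) _ (hw.mem _) (hw.ne three_pos (by omega) i)).resolve_left (h3 i),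
      hw.mem _, hw.mem _⟩)
  rcases ih (L - 2) (by omega) B R (fun x hx y hy h => (hW x hx y hy h).symm) (by omega) this with
    h | h | h | h
  · exact Or.inr (Or.inl h)
  · exact Or.inl h
  · exact Or.inr (Or.inr (Or.inr h))
  · exact Or.inr (Or.inr (Or.inl h))

/-- Two vertices of a clique are joined by paths of all sizes up to that of the clique. -/
lemma exists_path_of_clique {S : Finset V} (hS : ∀ x ∈ S, ∀ y ∈ S, x ≠ y → G.Adj x y) {a b : V}
    (ha : a ∈ S) (hb : b ∈ S) (hab : a ≠ b) {m : ℕ} (h2 : 2 ≤ m) (hm : m ≤ S.card) :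
    ∃ l, IsPathFrom G a b l ∧ l.length = m ∧ ∀ x ∈ l, x ∈ S := by
  obtain ⟨T, hT, haT, hbT, hc⟩ := exists_subset_card_of_pair ha hb hab h2 hm
  have hb' : b ∈ T.erase a := Finset.mem_erase.2 ⟨hab.symm, hbT⟩
  have c1 : ((T.erase a).erase b).card + 2 = T.card := by
    rw [← Finset.card_erase_add_one haT, ← Finset.card_erase_add_one hb']
  have hmem : ∀ x ∈ a :: (((T.erase a).erase b).toList ++ [b]), x ∈ S := by
    intro x hx
    simp only [List.mem_cons, List.mem_append, Finset.mem_toList, Finset.mem_erase,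
      List.not_mem_nil, or_false] at hx
    rcases hx with rfl | ⟨_, _, h⟩ | rfl
    exacts [ha, hT h, hb]
  have hnd : (a :: (((T.erase a).erase b).toList ++ [b])).Nodup := by
    rw [List.nodup_cons]
    refine ⟨by simp [hab], ?_⟩
    rw [List.nodup_append']
    exact ⟨Finset.nodup_toList _, by simp, by simp⟩
  refine ⟨_, ⟨hnd, ?_, rfl, ?_⟩, ?_, hmem⟩
  · refine List.Pairwise.isChain ?_
    exact List.Pairwise.imp_of_mem (fun {x y} hx hy h => hS x (hmem x hx) y (hmem y hy) h) hnd
  · rw [← List.cons_append, List.getLast?_append]; simp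
  · simp; omega

/-- In a complete graph on `W` covered by `R` and `B`, neither of which has a cycle with `2ℓ - 1`
vertices, a cycle of `R` with `2ℓ` vertices has all its chords of even length in `B`. -/
lemma even_chords {W : Finset V} {ℓ : ℕ} (hℓ : 3 ≤ ℓ)
    (hW : ∀ x ∈ W, ∀ y ∈ W, x ≠ y → R.Adj x y ∨ B.Adj x y)
    (hR : ¬ HasCycle R (2 * ℓ - 1)) (hB : ¬ HasCycle B (2 * ℓ - 1)) {w : ℕ → V}
    (hw : IsCyclicEnum (within R W) (2 * ℓ) w) (i t : ℕ) (ht : 1 ≤ t) (htℓ : t < ℓ) :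
    ¬ R.Adj (w i) (w (i + 2 * t)) := by
  have h2 : ∀ i, ¬ R.Adj (w i) (w (i + 2)) := by
    intro i hi
    have := (hw.hasCycle_of_chord (d := 2) (by omega) (by omega) ⟨hi, hw.mem _, hw.mem _⟩).mono
      (within_le R W)
    rw [show 2 * ℓ - 2 + 1 = 2 * ℓ - 1 by omega] at this
    exact hR this
  have hb2 : ∀ i, B.Adj (w i) (w (i + 2)) := fun i =>
    (hW _ (hw.mem _) _ (hw.mem _) (hw.ne two_pos (by omega) i)).resolve_left (h2 i)
  intro hRt
  rcases (show t = 1 ∨ t = ℓ - 1 ∨ (2 ≤ t ∧ t + 2 ≤ ℓ) by omega) with rfl | rfl | ⟨ht2, htℓ2⟩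
  · exact h2 i hRt
  · refine h2 (i + 2 * (ℓ - 1)) ?_
    rw [show i + 2 * (ℓ - 1) + 2 = i + 2 * ℓ by omega, hw.add_period]
    exact hRt.symm
  -- Renumber the cycle so that the chord joins the positions `0` and `2t`.
  set v : ℕ → V := fun j => w (i + j) with hv
  have hvw : IsCyclicEnum (within R W) (2 * ℓ) v := hw.shift i
  have hchord : R.Adj (v 0) (v (2 * t)) := hRt
  have hbv : ∀ j, B.Adj (v j) (v (j + 2)) := fun j => hb2 (i + j)
  have hper : v (2 * ℓ) = v 0 := by simpa using hvw.add_period 0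
  have harc : ∀ s k, k < 2 * ℓ → IsPathFrom R (v s) (v (s + k))
      ((List.range (k + 1)).map fun j => v (s + 1 * j)) := fun s k hk =>
    (hvw.arc s hk).mono fun _ _ _ _ h => h.1
  have hcross1 : ¬ R.Adj (v 1) (v (2 * t + 2)) := by
    intro h
    have p1 := harc 1 (2 * t - 1) (by omega)
    have p2 := harc (2 * t + 2) (2 * ℓ - 2 * t - 2) (by omega)
    rw [show 2 * t + 2 + (2 * ℓ - 2 * t - 2) = 2 * ℓ by omega, hper] at p2
    rw [show 1 + (2 * t - 1) = 2 * t by omega] at p1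
    refine hR ⟨_, _, _, p1.reverse.append p2 h ?_, hchord, by simp; omega⟩
    intro x hx hx'
    obtain ⟨j, hj, rfl⟩ := IsCyclicEnum.mem_path_step (List.mem_reverse.1 hx)
    obtain ⟨k, hk, hjk⟩ := IsCyclicEnum.mem_path_step hx'
    rw [hvw.inj] at hjk
    rcases (show k = 2 * ℓ - 2 * t - 2 ∨ k < 2 * ℓ - 2 * t - 2 by omega) with rfl | hk'
    · rw [show 2 * t + 2 + 1 * (2 * ℓ - 2 * t - 2) = 0 + 2 * ℓ by omega] at hjk
      have := Nat.ModEq.eq_of_lt_of_lt (hjk.trans (by simp [Nat.ModEq])) (by omega)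
        (show 0 < 2 * ℓ by omega)
      omega
    · have := Nat.ModEq.eq_of_lt_of_lt hjk (by omega) (by omega)
      omega
  have hcross2 : ¬ R.Adj (v (2 * ℓ - 1)) (v (2 * t - 2)) := by
    intro h
    have p1 := harc (2 * t) (2 * ℓ - 1 - 2 * t) (by omega)
    have p2 := harc 0 (2 * t - 2) (by omega)
    rw [show 2 * t + (2 * ℓ - 1 - 2 * t) = 2 * ℓ - 1 by omega] at p1
    rw [show 0 + (2 * t - 2) = 2 * t - 2 by omega] at p2
    refine hR ⟨_, _, _, p1.append p2.reverse h ?_, hchord, by simp; omega⟩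
    intro x hx hx'
    obtain ⟨j, hj, rfl⟩ := IsCyclicEnum.mem_path_step hx
    obtain ⟨k, hk, hjk⟩ := IsCyclicEnum.mem_path_step (List.mem_reverse.1 hx')
    rw [hvw.inj] at hjk
    have := Nat.ModEq.eq_of_lt_of_lt hjk (by omega) (by omega)
    omega
  have hblue : ∀ a b, ¬ a ≡ b [MOD 2 * ℓ] → ¬ R.Adj (v a) (v b) → B.Adj (v a) (v b) :=
    fun a b hab h =>
      (hW _ (hvw.mem a) _ (hvw.mem b) fun e => hab ((hvw.inj a b).1 e)).resolve_left h
  have hb1 : B.Adj (v 1) (v (2 * t + 2)) := by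
    refine hblue _ _ (fun h => ?_) hcross1
    have := (h.of_mul_right ℓ)
    simp only [Nat.ModEq] at this
    omega
  have hb3 : B.Adj (v (2 * ℓ - 1)) (v (2 * t - 2)) := by
    refine hblue _ _ (fun h => ?_) hcross2
    have := Nat.ModEq.eq_of_lt_of_lt h (by omega) (by omega)
    omega
  -- All odd positions, then all even positions except `2t`.
  have q1 := hvw.path_step (s := 1) (d := 2) (k := ℓ - 1) (B := B) two_pos (by omega)
    (fun j _ => hbv _)
  have q2 := hvw.path_step (s := 2 * t + 2) (d := 2) (k := ℓ - 2) (B := B) two_pos (by omega)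
    (fun j _ => hbv _)
  rw [show 1 + 2 * (ℓ - 1) = 2 * ℓ - 1 by omega] at q1
  rw [show 2 * t + 2 + 2 * (ℓ - 2) = (2 * t - 2) + 2 * ℓ by omega, hvw.add_period] at q2
  refine hB ⟨_, _, _, q1.append q2.reverse hb3 ?_, hb1.symm, by simp; omega⟩
  intro x hx hx'
  obtain ⟨j, hj, rfl⟩ := IsCyclicEnum.mem_path_step hx
  obtain ⟨k, hk, hjk⟩ := IsCyclicEnum.mem_path_step (List.mem_reverse.1 hx')
  rw [hvw.inj] at hjk
  have := hjk.of_mul_right ℓ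
  simp only [Nat.ModEq] at this
  omega

/-- In a complete graph on `W` covered by `R` and `B`, neither of which has a cycle with `2n + 1`
vertices, a cycle of `R` with `2n + 2` vertices yields a complete bipartite graph in `R` with parts
of `n` and `n + 1` vertices: the two colour classes of positions are cliques of `B`, and the edges
of `B` between them have a common end. -/
lemma exists_bip_of_even_cycle {W : Finset V} {n : ℕ} (hn : 2 ≤ n)
    (hW : ∀ x ∈ W, ∀ y ∈ W, x ≠ y → R.Adj x y ∨ B.Adj x y)
    (hR : ¬ HasCycle R (2 * n + 1)) (hB : ¬ HasCycle B (2 * n + 1))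
    (hc : HasCycle (within R W) (2 * n + 2)) :
    ∃ P Q : Finset V, P ⊆ W ∧ Q ⊆ W ∧ Disjoint P Q ∧ P.card = n ∧ Q.card = n + 1 ∧
      ∀ x ∈ P, ∀ y ∈ Q, R.Adj x y := by
  obtain ⟨w, hw⟩ := hc.exists_enum
  have hev := even_chords (R := R) (B := B) (ℓ := n + 1) (by omega) hW hR hB hw
  have hw' : ∀ i j, w i = w j ↔ i ≡ j [MOD 2 * (n + 1)] := hw.inj
  set E := (Finset.range (n + 1)).image fun j => w (2 * j) with hE
  set O := (Finset.range (n + 1)).image fun j => w (2 * j + 1) with hO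
  have hEc : E.card = n + 1 := by
    rw [hE, Finset.card_image_of_injOn, Finset.card_range]
    intro i hi j hj hij
    simp only [Finset.coe_range, Set.mem_Iio] at hi hj
    have := Nat.ModEq.eq_of_lt_of_lt ((hw' _ _).1 hij) (by omega) (by omega)
    omega
  have hOc : O.card = n + 1 := by
    rw [hO, Finset.card_image_of_injOn, Finset.card_range]
    intro i hi j hj hij
    simp only [Finset.coe_range, Set.mem_Iio] at hi hj
    have := Nat.ModEq.eq_of_lt_of_lt ((hw' _ _).1 hij) (by omega) (by omega)
    omega
  have hEO : Disjoint E O := by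
    rw [Finset.disjoint_left]
    intro x hx hx'
    obtain ⟨i, hi, rfl⟩ := Finset.mem_image.1 hx
    obtain ⟨j, hj, hij⟩ := Finset.mem_image.1 hx'
    simp only [Finset.mem_range] at hi hj
    have := Nat.ModEq.eq_of_lt_of_lt ((hw' _ _).1 hij) (by omega) (by omega)
    omega
  have hEW : E ⊆ W := by
    intro x hx
    obtain ⟨i, hi, rfl⟩ := Finset.mem_image.1 hx
    exact hw.mem _
  have hOW : O ⊆ W := by
    intro x hx
    obtain ⟨i, hi, rfl⟩ := Finset.mem_image.1 hx
    exact hw.mem _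
  have hcl : ∀ s i j, i < j → j < n + 1 → B.Adj (w (2 * i + s)) (w (2 * j + s)) := by
    intro s i j hij hj
    refine (hW _ (hw.mem _) _ (hw.mem _) ?_).resolve_left ?_
    · rw [show 2 * j + s = 2 * i + s + 2 * (j - i) by omega]
      exact hw.ne (by omega) (by omega) _
    · have := hev (2 * i + s) (j - i) (by omega) (by omega)
      rwa [show 2 * i + s + 2 * (j - i) = 2 * j + s by omega] at this
  have hclique : ∀ s, ∀ x ∈ (Finset.range (n + 1)).image (fun j => w (2 * j + s)),
      ∀ y ∈ (Finset.range (n + 1)).image (fun j => w (2 * j + s)), x ≠ y → B.Adj x y := by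
    intro s x hx y hy hxy
    obtain ⟨i, hi, rfl⟩ := Finset.mem_image.1 hx
    obtain ⟨j, hj, rfl⟩ := Finset.mem_image.1 hy
    simp only [Finset.mem_range] at hi hj
    rcases lt_trichotomy i j with h | h | h
    · exact hcl s i j h hj
    · exact absurd (by rw [h]) hxy
    · exact (hcl s j i h hi).symm
  have hEcl := hclique 0
  have hOcl := hclique 1
  simp only [add_zero] at hEcl
  -- Two disjoint cross edges of `B` would close up a cycle.
  have hmatch : ∀ e ∈ E, ∀ e' ∈ E, ∀ o ∈ O, ∀ o' ∈ O, e ≠ e' → o ≠ o' →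
      B.Adj e o → ¬ B.Adj e' o' := by
    intro e he e' he' o ho o' ho' hee hoo h1 h2
    obtain ⟨l, hl, hll, hlm⟩ := exists_path_of_clique hEcl he he' hee (m := n + 1) (by omega)
      (by rw [← hE, hEc])
    obtain ⟨l', hl', hll', hlm'⟩ := exists_path_of_clique hOcl ho' ho hoo.symm (m := n) (by omega)
      (by rw [← hO, hOc]; omega)
    refine hB ⟨_, _, _, hl.append hl' h2 ?_, h1.symm, by simp [hll, hll']; omega⟩
    intro x hx hx'
    exact Finset.disjoint_left.1 hEO (hlm x hx) (hlm' x hx')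
  have hRB : ∀ e ∈ E, ∀ o ∈ O, ¬ B.Adj e o → R.Adj e o := fun e he o ho h =>
    (hW e (hEW he) o (hOW ho) (fun h => Finset.disjoint_left.1 hEO he (h ▸ ho))).resolve_right h
  by_cases hex : ∃ e ∈ E, ∃ o ∈ O, B.Adj e o
  · obtain ⟨e, he, o, ho, heo⟩ := hex
    by_cases hcov : ∀ e' ∈ E, ∀ o' ∈ O, B.Adj e' o' → e' = e
    · refine ⟨E.erase e, O, (Finset.erase_subset _ _).trans hEW, hOW,
        Finset.disjoint_of_subset_left (Finset.erase_subset _ _) hEO, ?_, hOc, ?_⟩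
      · rw [Finset.card_erase_of_mem he, hEc]; rfl
      · intro x hx y hy
        have hx' := Finset.mem_erase.1 hx
        exact hRB x hx'.2 y hy fun h => hx'.1 (hcov x hx'.2 y hy h)
    · push Not at hcov
      obtain ⟨e', he', o', ho', h', hne⟩ := hcov
      obtain rfl : o' = o := by
        by_contra hoo
        exact hmatch e he e' he' o ho o' ho' hne.symm (Ne.symm hoo) heo h'
      refine ⟨O.erase o', E, (Finset.erase_subset _ _).trans hOW, hEW,
        (Finset.disjoint_of_subset_right (Finset.erase_subset _ _) hEO).symm, ?_, hEc, ?_⟩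
      · rw [Finset.card_erase_of_mem ho, hOc]; rfl
      · intro y hy x hx
        have hy' := Finset.mem_erase.1 hy
        refine (hRB x hx y hy'.2 fun h => ?_).symm
        rcases eq_or_ne x e with rfl | hxe
        · exact hmatch x he e' he' y hy'.2 o' ho hne.symm hy'.1 h h'
        · exact hmatch e he x hx o' ho y hy'.2 hxe.symm hy'.1.symm heo h
  · push Not at hex
    obtain ⟨E', hE', hE'c⟩ := Finset.exists_subset_card_eq (s := E) (n := n) (by omega)
    exact ⟨E', O, hE'.trans hEW, hOW, Finset.disjoint_of_subset_left hE' hEO, hE'c, hOc,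
      fun x hx y hy => hRB x (hE' hx) y hy (hex x (hE' hx) y hy)⟩

/-- Let the complete graph on `W` be covered by `R` and `B`, let the vertices of `XR` be joined
to `W` in `R` and those of `XB` in `B`, with at least `4n + 1` vertices altogether. If `R` contains
a complete bipartite graph in `W` with parts of `n` and `n + 1` vertices, then `R` or `B` has a
cycle with `2n + 1` vertices. -/
lemma hasCycle_of_bip {W XR XB P Q : Finset V} {n : ℕ} (hn : 2 ≤ n)
    (hW : ∀ x ∈ W, ∀ y ∈ W, x ≠ y → R.Adj x y ∨ B.Adj x y)
    (hXR : ∀ x ∈ XR, ∀ y ∈ W, R.Adj x y) (hXB : ∀ x ∈ XB, ∀ y ∈ W, B.Adj x y)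
    (hWR : Disjoint W XR) (hWB : Disjoint W XB)
    (hcard : 4 * n + 1 ≤ W.card + XR.card + XB.card)
    (hPW : P ⊆ W) (hQW : Q ⊆ W) (hPQ : Disjoint P Q) (hP : P.card = n) (hQ : Q.card = n + 1)
    (hc : ∀ x ∈ P, ∀ y ∈ Q, R.Adj x y) :
    HasCycle R (2 * n + 1) ∨ HasCycle B (2 * n + 1) := by
  classical
  by_contra hno
  push Not at hno
  obtain ⟨hR, hB⟩ := hno
  have hc' : ∀ y ∈ Q, ∀ x ∈ P, R.Adj y x := fun y hy x hx => (hc x hx y hy).symm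
  have hQB : ∀ x ∈ Q, ∀ y ∈ Q, x ≠ y → B.Adj x y := fun x hx y hy hxy =>
    (hW x (hQW hx) y (hQW hy) hxy).resolve_left fun h =>
      hR (hasCycle_of_bip_edge (by omega) hPQ.symm hc' hQ.ge hP.ge hx hy h)
  obtain ⟨p₀, hp₀⟩ : P.Nonempty := Finset.card_pos.1 (by omega)
  obtain ⟨q₁, hq₁⟩ : Q.Nonempty := Finset.card_pos.1 (by omega)
  have hapex : ∀ z ∉ P, z ∉ Q → ∀ p ∈ P, ∀ q ∈ Q, R.Adj z p → ¬ R.Adj z q :=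
    fun z hzP hzQ p hp q hq h1 h2 => hR
      (hasCycle_of_bip_apex hn hPQ hc hP.ge (by omega) hp hq hzP hzQ h1 h2)
  have hXR0 : XR = ∅ := by
    rw [Finset.eq_empty_iff_forall_notMem]
    intro x hx
    have hxW : x ∉ W := fun h => Finset.disjoint_left.1 hWR h hx
    exact hapex x (fun h => hxW (hPW h)) (fun h => hxW (hQW h)) p₀ hp₀ q₁ hq₁
      (hXR x hx _ (hPW hp₀)) (hXR x hx _ (hQW hq₁))
  rw [hXR0, Finset.card_empty] at hcard
  set Z := (W \ (P ∪ Q)) ∪ XB with hZ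
  have hZc : 2 * n ≤ Z.card := by
    rw [hZ, Finset.card_union_of_disjoint (Finset.disjoint_of_subset_left Finset.sdiff_subset hWB),
      Finset.card_sdiff_of_subset (Finset.union_subset hPW hQW), Finset.card_union_of_disjoint hPQ]
    omega
  have hZPQ : ∀ z ∈ Z, z ∉ P ∧ z ∉ Q := by
    intro z hz
    rcases Finset.mem_union.1 hz with h | h
    · have := (Finset.mem_sdiff.1 h).2
      simpa [not_or] using this
    · exact ⟨fun h' => Finset.disjoint_left.1 hWB (hPW h') h,
        fun h' => Finset.disjoint_left.1 hWB (hQW h') h⟩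
  set ZQ := Z.filter fun z => ∀ q ∈ Q, B.Adj q z with hZQ
  set ZP := Z.filter fun z => ¬ ∀ q ∈ Q, B.Adj q z with hZP
  have hsum : ZQ.card + ZP.card = Z.card := Finset.card_filter_add_card_filter_not _
  obtain ⟨q₂, hq₂, hq₁₂⟩ := Finset.exists_mem_ne (s := Q) (by omega) q₁
  have hZQc : ZQ.card < n := by
    by_contra hge
    refine hB (hasCycle_of_bip_edge (P := Q) (Q := ZQ) (by omega) ?_ ?_ hQ.ge (by omega) hq₁ hq₂
      (hQB _ hq₁ _ hq₂ hq₁₂.symm))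
    · rw [Finset.disjoint_right]
      intro z hz
      exact (hZPQ z (Finset.mem_filter.1 hz).1).2
    · intro q hq z hz
      exact (Finset.mem_filter.1 hz).2 q hq
  -- The remaining vertices lie in `W` and have a neighbour in `Q`, hence none in `P`, in `R`.
  have hZP1 : ∀ z ∈ ZP, z ∈ W ∧ z ∉ P ∧ z ∉ Q ∧ ∃ q ∈ Q, R.Adj z q := by
    intro z hz
    obtain ⟨hzZ, hzn⟩ := Finset.mem_filter.1 hz
    obtain ⟨h1, h2⟩ := hZPQ z hzZ
    push Not at hzn
    obtain ⟨q, hq, hqz⟩ := hzn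
    have hzW : z ∈ W := by
      rcases Finset.mem_union.1 hzZ with h | h
      · exact (Finset.mem_sdiff.1 h).1
      · exact absurd (hXB z h q (hQW hq)).symm hqz
    refine ⟨hzW, h1, h2, q, hq, ?_⟩
    exact (hW z hzW q (hQW hq) (fun h => h2 (h ▸ hq))).resolve_right fun h => hqz h.symm
  have hZPB : ∀ z ∈ ZP, ∀ p ∈ P, B.Adj z p := by
    intro z hz p hp
    obtain ⟨hzW, h1, h2, q, hq, hzq⟩ := hZP1 z hz
    exact (hW z hzW p (hPW hp) (fun h => h1 (h ▸ hp))).resolve_left fun h =>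
      hapex z h1 h2 p hp q hq h hzq
  have hZPP : Disjoint ZP P := Finset.disjoint_left.2 fun z hz => (hZP1 z hz).2.1
  have hZPR : ∀ z ∈ ZP, ∀ z' ∈ ZP, z ≠ z' → R.Adj z z' := fun z hz z' hz' hne =>
    (hW z (hZP1 z hz).1 z' (hZP1 z' hz').1 hne).resolve_right fun h =>
      hB (hasCycle_of_bip_edge (by omega) hZPP hZPB (by omega) hP.ge hz hz' h)
  have huniq : ∀ z ∈ ZP, ∀ z' ∈ ZP, z ≠ z' → ∀ q ∈ Q, ∀ q' ∈ Q, R.Adj z q → R.Adj z' q' →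
      q = q' := by
    intro z hz z' hz' hne q hq q' hq' h1 h2
    by_contra hqq
    obtain ⟨-, h3, h4, -⟩ := hZP1 z hz
    obtain ⟨-, h5, h6, -⟩ := hZP1 z' hz'
    exact hR (hasCycle_of_bip_outer_edge hn hPQ hc (by omega) (by omega) hq hq' hqq h3 h4 h5 h6
      (hZPR z hz z' hz' hne) h1 h2)
  obtain ⟨z₁, hz₁⟩ : ZP.Nonempty := Finset.card_pos.1 (by omega)
  obtain ⟨z₂, hz₂, hz₁₂⟩ := Finset.exists_mem_ne (s := ZP) (by omega) z₁
  obtain ⟨-, -, -, q₀, hq₀, hzq₀⟩ := hZP1 z₁ hz₁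
  have hall : ∀ z ∈ ZP, ∀ q ∈ Q, R.Adj z q → q = q₀ := by
    intro z hz q hq h
    rcases eq_or_ne z z₁ with rfl | hne
    · obtain ⟨-, -, -, q', hq', hzq'⟩ := hZP1 z₂ hz₂
      rw [huniq z hz z₂ hz₂ hz₁₂.symm q hq q' hq' h hzq',
        huniq z hz z₂ hz₂ hz₁₂.symm q₀ hq₀ q' hq' hzq₀ hzq']
    · exact huniq z hz z₁ hz₁ hne q hq q₀ hq₀ h hzq₀
  -- So `B` joins `ZP` to `P` and to `Q` without `q₀`, and the latter is a clique of `B`.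
  have hQ0 : 1 < (Q.erase q₀).card := by rw [Finset.card_erase_of_mem hq₀]; omega
  obtain ⟨s, hs, s', hs', hss⟩ := Finset.one_lt_card.1 hQ0
  refine hB (hasCycle_of_bip_edge (P := P ∪ Q.erase q₀) (Q := ZP) (by omega) ?_ ?_ ?_ (by omega)
    (Finset.mem_union_right _ hs) (Finset.mem_union_right _ hs')
    (hQB s (Finset.mem_of_mem_erase hs) s' (Finset.mem_of_mem_erase hs') hss))
  · rw [Finset.disjoint_right]
    intro z hz h
    obtain ⟨-, h1, h2, -⟩ := hZP1 z hz
    rcases Finset.mem_union.1 h with h | h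
    · exact h1 h
    · exact h2 (Finset.mem_of_mem_erase h)
  · intro x hx z hz
    obtain ⟨hzW, h1, h2, -⟩ := hZP1 z hz
    rcases Finset.mem_union.1 hx with h | h
    · exact (hZPB z hz x h).symm
    · obtain ⟨hx1, hx2⟩ := Finset.mem_erase.1 h
      exact ((hW z hzW x (hQW hx2) (fun h => h2 (h ▸ hx2))).resolve_left fun h =>
        hx1 (hall z hz x hx2 h)).symm
  · rw [Finset.card_union_of_disjoint
      (Finset.disjoint_of_subset_right (Finset.erase_subset _ _) hPQ), Finset.card_erase_of_mem hq₀]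
    omega

end

/-! ### The two-colour Ramsey number of an odd cycle -/

section

variable {V : Type*} [DecidableEq V] {R B : SimpleGraph V}

/-- Removing vertices with at most `d` neighbours in the rest one by one either succeeds `m` times
or stops at a set in which all degrees exceed `d`. -/
lemma exists_sparse_or_dense (G : SimpleGraph V) [DecidableRel G.Adj] (U : Finset V) (d : ℕ) :
    ∀ m : ℕ, (∃ T ⊆ U, T.card = m ∧ ∀ t ∈ T, ((U \ T).filter (G.Adj t)).card ≤ d) ∨
      ∃ H ⊆ U, U.card < H.card + m ∧ ∀ x ∈ H, d + 1 ≤ (H.filter (G.Adj x)).card := by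
  intro m
  induction m with
  | zero => exact Or.inl ⟨∅, by simp, by simp, by simp⟩
  | succ m ih =>
    rcases ih with ⟨T, hTU, hT, hdeg⟩ | ⟨H, hHU, hH, hdeg⟩
    · by_cases hall : ∀ x ∈ U \ T, d + 1 ≤ ((U \ T).filter (G.Adj x)).card
      · refine Or.inr ⟨U \ T, Finset.sdiff_subset, ?_, hall⟩
        have := Finset.card_sdiff_add_card_eq_card hTU
        omega
      · push Not at hall
        obtain ⟨x, hx, hxd⟩ := hall
        obtain ⟨hxU, hxT⟩ := Finset.mem_sdiff.1 hx
        have hsub : ∀ t, ((U \ insert x T).filter (G.Adj t)).card ≤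
            ((U \ T).filter (G.Adj t)).card := fun t =>
          Finset.card_le_card (Finset.filter_subset_filter _
            (Finset.sdiff_subset_sdiff le_rfl (Finset.subset_insert _ _)))
        refine Or.inl ⟨insert x T, Finset.insert_subset hxU hTU, ?_, ?_⟩
        · rw [Finset.card_insert_of_notMem hxT, hT]
        · intro t ht
          refine (hsub t).trans ?_
          rcases Finset.mem_insert.1 ht with rfl | ht
          · omega
          · exact hdeg t ht
    · exact Or.inr ⟨H, hHU, by omega, hdeg⟩

/-- If each of the `n` vertices of `T` is non-adjacent to fewer than `n` vertices of the large
set `Y`, then either there is a cycle with `2n + 1` vertices or `Y` contains an independent set of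
`2n + 1` vertices, formed by vertices with at least two neighbours in `T`. -/
lemma hasCycle_or_independent [DecidableRel B.Adj] {n : ℕ} (hn : 2 ≤ n) {T Y : Finset V}
    (hT : T.card = n) (hTY : Disjoint T Y) (hY : 3 * n + 1 ≤ Y.card)
    (hdeg : ∀ t ∈ T, (Y.filter fun y => ¬ B.Adj t y).card + 1 ≤ n) :
    HasCycle B (2 * n + 1) ∨
      ∃ Z ⊆ Y, 2 * n + 1 ≤ Z.card ∧ ∀ x ∈ Z, ∀ y ∈ Z, ¬ B.Adj x y := by
  by_cases hcyc : HasCycle B (2 * n + 1)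
  · exact Or.inl hcyc
  right
  set Z := Y.filter fun y => 2 ≤ (T.filter fun t => B.Adj t y).card with hZ
  set Z' := Y.filter fun y => ¬ 2 ≤ (T.filter fun t => B.Adj t y).card with hZ'
  have hsum : Z.card + Z'.card = Y.card := Finset.card_filter_add_card_filter_not _
  -- Double counting of the non-adjacent pairs.
  have hcount : Z'.card * (n - 1) ≤ n * (n - 1) := by
    have h1 : ∀ y ∈ Z', n - 1 ≤ (T.filter fun t => ¬ B.Adj t y).card := by
      intro y hy
      have h2 := (Finset.mem_filter.1 hy).2
      have h3 := Finset.card_filter_add_card_filter_not (s := T) fun t => B.Adj t y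
      omega
    calc Z'.card * (n - 1) = ∑ y ∈ Z', (n - 1) := by simp
      _ ≤ ∑ y ∈ Z', (T.filter fun t => ¬ B.Adj t y).card := Finset.sum_le_sum h1
      _ ≤ ∑ y ∈ Y, (T.filter fun t => ¬ B.Adj t y).card :=
        Finset.sum_le_sum_of_subset (Finset.filter_subset _ _)
      _ = ∑ t ∈ T, (Y.filter fun y => ¬ B.Adj t y).card := by
        simp only [Finset.card_filter]; exact Finset.sum_comm
      _ ≤ ∑ t ∈ T, (n - 1) := Finset.sum_le_sum fun t ht => by have := hdeg t ht; omega
      _ = n * (n - 1) := by simp [hT]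
  have hZ'n : Z'.card ≤ n := Nat.le_of_mul_le_mul_right hcount (by omega)
  refine ⟨Z, Finset.filter_subset _ _, by omega, ?_⟩
  intro y hy y' hy' hyy
  obtain ⟨hyY, hy2⟩ := Finset.mem_filter.1 hy
  obtain ⟨hyY', hy2'⟩ := Finset.mem_filter.1 hy'
  obtain ⟨t, ht⟩ : (T.filter fun t => B.Adj t y).Nonempty := Finset.card_pos.1 (by omega)
  obtain ⟨t', ht', htt⟩ := Finset.exists_mem_ne (s := T.filter fun t => B.Adj t y') (by omega) t
  obtain ⟨htT, hty⟩ := Finset.mem_filter.1 ht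
  obtain ⟨htT', hty'⟩ := Finset.mem_filter.1 ht'
  refine hcyc (hasCycle_of_edge_between (Y := (Y.erase y).erase y') hT ?_ htT htT' htt.symm
    (Finset.disjoint_right.1 hTY hyY) (Finset.disjoint_right.1 hTY hyY') (by simp) (by simp) hyy
    hty.symm hty'.symm ?_)
  · exact Finset.disjoint_of_subset_right
      ((Finset.erase_subset _ _).trans (Finset.erase_subset _ _)) hTY
  · intro x hx z hz _
    have h1 : Y \ (insert y (insert y' ((Y.filter fun w => ¬ B.Adj x w) ∪
        (Y.filter fun w => ¬ B.Adj z w)))) ⊆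
        ((Y.erase y).erase y').filter fun w => B.Adj x w ∧ B.Adj z w := by
      intro w hw
      simp only [Finset.mem_sdiff, Finset.mem_insert, Finset.mem_union, Finset.mem_filter,
        not_or, not_and, not_not] at hw
      obtain ⟨hwY, h1, h2, h3, h4⟩ := hw
      simp only [Finset.mem_filter, Finset.mem_erase]
      exact ⟨⟨h2, h1, hwY⟩, h3 hwY, h4 hwY⟩
    have h2 := Finset.card_le_card h1
    have h3 := Finset.le_card_sdiff (insert y (insert y' ((Y.filter fun w => ¬ B.Adj x w) ∪
        (Y.filter fun w => ¬ B.Adj z w)))) Y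
    have h4 := Finset.card_insert_le y (insert y' ((Y.filter fun w => ¬ B.Adj x w) ∪
        (Y.filter fun w => ¬ B.Adj z w)))
    have h5 := Finset.card_insert_le y' ((Y.filter fun w => ¬ B.Adj x w) ∪
        (Y.filter fun w => ¬ B.Adj z w))
    have h6 := Finset.card_union_le (Y.filter fun w => ¬ B.Adj x w) (Y.filter fun w => ¬ B.Adj z w)
    have h7 := hdeg x hx
    have h8 := hdeg z hz
    omega

/-- The edges of `G` inside `W ∪ X` with at least one end in `W`. -/
def touching (G : SimpleGraph V) (W X : Finset V) : SimpleGraph V where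
  Adj x y := G.Adj x y ∧ x ∈ W ∪ X ∧ y ∈ W ∪ X ∧ (x ∈ W ∨ y ∈ W)
  symm := ⟨fun _ _ h => ⟨h.1.symm, h.2.2.1, h.2.1, h.2.2.2.symm⟩⟩
  loopless := ⟨fun _ h => h.1.ne rfl⟩

lemma touching_le (G : SimpleGraph V) (W X : Finset V) : touching G W X ≤ G := fun _ _ h => h.1

/-- The descent of `descend_cycle` in the presence of fewer than `n` vertices `X` joined to `W`
in `R`. -/
lemma descend_touching {W X : Finset V} {n : ℕ} (hn : 2 ≤ n)
    (hW : ∀ x ∈ W, ∀ y ∈ W, x ≠ y → R.Adj x y ∨ B.Adj x y) (hX : ∀ x ∈ X, ∀ y ∈ W, R.Adj x y)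
    (hXc : X.card + 1 ≤ n) : ∀ L, 2 * n + 1 ≤ L → HasCycle (touching R W X) L →
      HasCycle R (2 * n + 1) ∨ HasCycle B (2 * n + 1) ∨ HasCycle (within R W) (2 * n + 2) ∨
        HasCycle (within B W) (2 * n + 2) := by
  intro L
  induction L using Nat.strong_induction_on with
  | _ L ih =>
  intro hL hc
  rcases hL.eq_or_lt with rfl | hL
  · exact Or.inl (hc.mono (touching_le R W X))
  obtain ⟨w, hw⟩ := hc.exists_enum
  have hmem : ∀ i, w i ∈ W ∪ X := fun i => (hw.adj i).2.1
  have hWX : ∀ i, w i ∉ W → w i ∈ X := fun i hi => (Finset.mem_union.1 (hmem i)).resolve_left hi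
  have hnext : ∀ i, w i ∉ W → w (i + 1) ∈ W := fun i hi => (hw.adj i).2.2.2.resolve_left hi
  by_cases hall : ∀ i, w i ∈ W
  · have hcW : HasCycle (within R W) L := by
      -- Read the cycle off its enumeration, all of whose vertices lie in `W`.
      have hw' : IsCyclicEnum (within R W) L w :=
        ⟨hw.inj, fun i => ⟨(hw.adj i).1, hall i, hall (i + 1)⟩⟩
      have h1 := hw'.hasCycle_of_chord (d := 1) (i := 0) le_rfl (by omega) (hw'.adj 0)
      rwa [Nat.sub_add_cancel (by omega)] at h1
    rcases descend_cycle (m := 2 * n + 1) (by omega) L R B hW hL.le hcW with h | h | h | h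
    · exact Or.inl (h.mono (within_le R W))
    · exact Or.inr (Or.inl (h.mono (within_le B W)))
    · exact Or.inr (Or.inr (Or.inl h))
    · exact Or.inr (Or.inr (Or.inr h))
  by_cases h2 : ∃ i, w i ∉ W ∧ w (i + 2) ∈ W
  · obtain ⟨i, hi, hi2⟩ := h2
    exact ih (L - 2 + 1) (by omega) (by omega) (hw.hasCycle_of_chord (by omega) (by omega)
      ⟨hX _ (hWX i hi) _ hi2, hmem _, hmem _, Or.inr hi2⟩)
  push Not at hall h2
  obtain ⟨i, hi⟩ := hall
  by_cases hL' : L = 2 * n + 2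
  · -- All positions of the parity of `i` would lie in `X`, which is too small.
    exfalso
    have hpar : ∀ j, w (i + 2 * j) ∉ W := by
      intro j
      induction j with
      | zero => simpa using hi
      | succ j ihj => exact h2 _ ihj
    have hinj : ((Finset.range (n + 1)).image fun j => w (i + 2 * j)).card = n + 1 := by
      rw [Finset.card_image_of_injOn, Finset.card_range]
      intro a ha b hb hab
      simp only [Finset.coe_range, Set.mem_Iio] at ha hb
      have := Nat.ModEq.eq_of_lt_of_lt (Nat.ModEq.add_left_cancel' i ((hw.inj _ _).1 hab))
        (by omega) (by omega)
      omega
    have hsub : ((Finset.range (n + 1)).image fun j => w (i + 2 * j)) ⊆ X := by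
      intro x hx
      obtain ⟨j, -, rfl⟩ := Finset.mem_image.1 hx
      exact hWX _ (hpar j)
    have := Finset.card_le_card hsub
    omega
  · have h3 : w (i + 3) ∈ W := hnext (i + 2) (h2 i hi)
    exact ih (L - 3 + 1) (by omega) (by omega) (hw.hasCycle_of_chord (by omega) (by omega)
      ⟨hX _ (hWX i hi) _ h3, hmem _, hmem _, Or.inr h3⟩)

/-- A strengthening of the theorem of Bondy and Erdős on the two-colour Ramsey number of an odd
cycle: the complete graph on `W` is covered by `R` and `B`, and fewer than `n` further vertices
`XR` and `XB` are joined to `W` in `R` and in `B`, respectively. If there are more than `4n`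
vertices altogether, then `R` or `B` has a cycle with `2n + 1` vertices. -/
theorem hasCycle_of_two_colors {W XR XB : Finset V} {n : ℕ} (hn : 2 ≤ n)
    (hW : ∀ x ∈ W, ∀ y ∈ W, x ≠ y → R.Adj x y ∨ B.Adj x y)
    (hXR : ∀ x ∈ XR, ∀ y ∈ W, R.Adj x y) (hXB : ∀ x ∈ XB, ∀ y ∈ W, B.Adj x y)
    (hWR : Disjoint W XR) (hWB : Disjoint W XB) (hRB : Disjoint XR XB)
    (hR : XR.card + 1 ≤ n) (hB : XB.card + 1 ≤ n)
    (hcard : 4 * n + 1 ≤ W.card + XR.card + XB.card) :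
    HasCycle R (2 * n + 1) ∨ HasCycle B (2 * n + 1) := by
  classical
  by_cases hRc : HasCycle R (2 * n + 1)
  · exact Or.inl hRc
  by_cases hBc : HasCycle B (2 * n + 1)
  · exact Or.inr hBc
  have hW' : ∀ x ∈ W, ∀ y ∈ W, x ≠ y → B.Adj x y ∨ R.Adj x y :=
    fun x hx y hy h => (hW x hx y hy h).symm
  set U := W ∪ XR with hU
  have hUc : U.card = W.card + XR.card := Finset.card_union_of_disjoint hWR
  have hUXB : Disjoint U XB := Finset.disjoint_union_left.2 ⟨hWB, hRB⟩
  have hUX : ∀ {x}, x ∈ U → x ∉ W → x ∈ XR := fun h h' => (Finset.mem_union.1 h).resolve_left h'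
  have hcov : ∀ x ∈ W, ∀ y ∈ U, x ≠ y → ¬ B.Adj x y → (touching R W XR).Adj x y := by
    intro x hx y hy hxy h
    refine ⟨?_, Finset.mem_union_left _ hx, hy, Or.inl hx⟩
    by_cases hyW : y ∈ W
    · exact (hW x hx y hyW hxy).resolve_right h
    · exact (hXR y (hUX hy hyW) x hx).symm
  rcases exists_sparse_or_dense (touching R W XR) U (n - 1) (n - XB.card) with
    ⟨T, hTU, hT, hdeg⟩ | ⟨H, hHU, hH, hdeg⟩
  · -- The `n` vertices `T ∪ XB` send few edges outside `B` to the rest.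
    have hYc := Finset.card_sdiff_add_card_eq_card hTU
    have hTW : T ⊆ W := by
      intro t ht
      by_contra htW
      have htX := hUX (hTU ht) htW
      have hsub : (U \ T) \ XR ⊆ (U \ T).filter ((touching R W XR).Adj t) := by
        intro y hy
        obtain ⟨hy1, hy2⟩ := Finset.mem_sdiff.1 hy
        have hyU := (Finset.mem_sdiff.1 hy1).1
        have hyW : y ∈ W := by by_contra h; exact hy2 (hUX hyU h)
        exact Finset.mem_filter.2 ⟨hy1, hXR t htX y hyW, hTU ht, hyU, Or.inr hyW⟩
      have h1 := Finset.card_le_card hsub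
      have h2 := Finset.le_card_sdiff XR (U \ T)
      have h3 := hdeg t ht
      omega
    have hTc : (T ∪ XB).card = n := by
      rw [Finset.card_union_of_disjoint (Finset.disjoint_of_subset_left hTU hUXB), hT]
      omega
    have hTd : Disjoint (T ∪ XB) (U \ T) := by
      rw [Finset.disjoint_union_left]
      exact ⟨Finset.disjoint_sdiff, Finset.disjoint_of_subset_right Finset.sdiff_subset hUXB.symm⟩
    have hTn : ∀ t ∈ T ∪ XB, ((U \ T).filter fun y => ¬ B.Adj t y).card + 1 ≤ n := by
      intro t ht
      rcases Finset.mem_union.1 ht with ht | ht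
      · have hsub : ((U \ T).filter fun y => ¬ B.Adj t y) ⊆
            (U \ T).filter ((touching R W XR).Adj t) := by
          intro y hy
          obtain ⟨hy1, hy2⟩ := Finset.mem_filter.1 hy
          refine Finset.mem_filter.2 ⟨hy1, hcov t (hTW ht) y (Finset.mem_sdiff.1 hy1).1 ?_ hy2⟩
          rintro rfl
          exact (Finset.mem_sdiff.1 hy1).2 ht
        have h1 := Finset.card_le_card hsub
        have h2 := hdeg t ht
        omega
      · have hsub : ((U \ T).filter fun y => ¬ B.Adj t y) ⊆ XR := by
          intro y hy
          obtain ⟨hy1, hy2⟩ := Finset.mem_filter.1 hy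
          exact hUX (Finset.mem_sdiff.1 hy1).1 fun h => hy2 (hXB t ht y h)
        have h1 := Finset.card_le_card hsub
        omega
    rcases hasCycle_or_independent (B := B) (T := T ∪ XB) (Y := U \ T) hn hTc hTd (by omega)
      hTn with h | ⟨Z, hZU, hZ, hind⟩
    · exact Or.inr h
    · left
      refine hasCycle_of_few_nonadj (by omega) hZ fun x hx => ?_
      have hxU := (Finset.mem_sdiff.1 (hZU hx)).1
      by_cases hxW : x ∈ W
      · refine ⟨∅, by simp; omega, fun y hy hyx _ => ?_⟩
        exact (hcov x hxW y (Finset.mem_sdiff.1 (hZU hy)).1 hyx.symm (hind x hx y hy)).1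
      · refine ⟨XR, hR, fun y hy hyx hyX => ?_⟩
        have hyU := (Finset.mem_sdiff.1 (hZU hy)).1
        have hyW : y ∈ W := by by_contra h; exact hyX (hUX hyU h)
        exact hXR x (hUX hxU hxW) y hyW
  · have hHne : H.Nonempty := Finset.card_pos.1 (by omega)
    rcases long_cycle_or_sparse_pair (G := touching R W XR) (n := n) hHne
      (fun x hx => by have := hdeg x hx; omega) with
      ⟨L, hL, -, hc⟩ | ⟨T, M, hTH, hMH, hTM, hT, hM, hno⟩
    · rcases descend_touching hn hW hXR hR L hL hc with h | h | h | h
      · exact Or.inl h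
      · exact Or.inr h
      · obtain ⟨P, Q, hPW, hQW, hPQ, hP, hQ, hcomp⟩ :=
          exists_bip_of_even_cycle hn hW hRc hBc h
        exact hasCycle_of_bip hn hW hXR hXB hWR hWB hcard hPW hQW hPQ hP hQ hcomp
      · obtain ⟨P, Q, hPW, hQW, hPQ, hP, hQ, hcomp⟩ :=
          exists_bip_of_even_cycle hn hW' hBc hRc h
        exact (hasCycle_of_bip hn hW' hXB hXR hWB hWR (by omega) hPW hQW hPQ hP hQ hcomp).symm
    · -- The vertices of `T` are joined in `B` to all of `H \ M`.
      have hc := Finset.card_sdiff_add_card_eq_card hMH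
      have hTW : T ⊆ W := by
        intro t ht
        by_contra htW
        have htX := hUX (hHU (hTH ht)) htW
        have hsub : H \ M ⊆ XR := by
          intro y hy
          obtain ⟨hyH, hyM⟩ := Finset.mem_sdiff.1 hy
          refine hUX (hHU hyH) fun hyW => hno t ht y hyH hyM ?_
          exact ⟨hXR t htX y hyW, hHU (hTH ht), hHU hyH, Or.inr hyW⟩
        have := Finset.card_le_card hsub
        omega
      have hYW : H \ M ⊆ W := by
        intro y hy
        obtain ⟨hyH, hyM⟩ := Finset.mem_sdiff.1 hy
        obtain ⟨t, ht⟩ : T.Nonempty := Finset.card_pos.1 (by omega)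
        by_contra hyW
        refine hno t ht y hyH hyM ?_
        exact ⟨(hXR y (hUX (hHU hyH) hyW) t (hTW ht)).symm, hHU (hTH ht), hHU hyH, Or.inl (hTW ht)⟩
      obtain ⟨P, hPT, hP⟩ := Finset.exists_subset_card_eq hT
      obtain ⟨Q, hQY, hQ⟩ := Finset.exists_subset_card_eq (s := H \ M) (n := n + 1) (by omega)
      have hPQ : Disjoint P Q := by
        rw [Finset.disjoint_left]
        intro x hx hx'
        exact (Finset.mem_sdiff.1 (hQY hx')).2 (hTM (hPT hx))
      refine (hasCycle_of_bip hn hW' hXB hXR hWB hWR (by omega) (hPT.trans hTW) (hQY.trans hYW) hPQ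
        hP hQ fun x hx y hy => ?_).symm
      obtain ⟨hyH, hyM⟩ := Finset.mem_sdiff.1 (hQY hy)
      by_contra hB'
      exact hno x (hPT hx) y hyH hyM (hcov x (hTW (hPT hx)) y (hHU hyH)
        (fun h => Finset.disjoint_left.1 hPQ hx (h ▸ hy)) hB')

end

/-! ### Gallai's structure theorem -/

section

variable {V : Type*} [DecidableEq V] {K : Type*}

/-- The colour classes of a Gallai colouring of the complete graph on `V`: any two distinct
vertices are adjacent in exactly one of the graphs, and no triangle meets three of them. -/
structure IsGallaiFamily (G : K → SimpleGraph V) : Prop where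
  cover : ∀ {x y}, x ≠ y → ∃ i, (G i).Adj x y
  unique : ∀ {x y i j}, (G i).Adj x y → (G j).Adj x y → i = j
  no_rainbow : ∀ {x y z i j l}, (G i).Adj x y → (G j).Adj y z → (G l).Adj x z →
    i = j ∨ j = l ∨ i = l

/-- `G` induces a disconnected graph on `W`, witnessed by a bipartition of `W`. -/
def Disconn (G : SimpleGraph V) (W : Finset V) : Prop :=
  ∃ D ⊆ W, D.Nonempty ∧ (W \ D).Nonempty ∧ ∀ x ∈ D, ∀ y ∈ W \ D, ¬ G.Adj x y

lemma mem_of_reachable_within {G : SimpleGraph V} {W : Finset V} {x y : V} (hx : x ∈ W)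
    (h : (within G W).Reachable x y) : y ∈ W := by
  rw [SimpleGraph.reachable_iff_reflTransGen] at h
  induction h with
  | refl => exact hx
  | tail _ h _ => exact h.2.2

lemma Disconn.exists_not_reachable {G : SimpleGraph V} {W : Finset V} (h : Disconn G W)
    (y : V) : ∃ z ∈ W, ¬ (within G W).Reachable y z := by
  obtain ⟨D, hDW, ⟨a, ha⟩, ⟨b, hb⟩, hno⟩ := h
  by_contra! hall
  have hab : (within G W).Reachable a b := (hall a (hDW ha)).symm.trans
    (hall b (Finset.mem_sdiff.1 hb).1)
  have hmem : b ∈ D := by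
    clear hb
    rw [SimpleGraph.reachable_iff_reflTransGen] at hab
    induction hab with
    | refl => exact ha
    | @tail u w _ h ih =>
      by_contra hw
      exact hno u ih w (Finset.mem_sdiff.2 ⟨h.2.2, hw⟩) h.1
  exact (Finset.mem_sdiff.1 hb).2 hmem

namespace IsGallaiFamily

variable {G : K → SimpleGraph V} (hG : IsGallaiFamily G)
include hG

/-- The components of a colour class are modules: they are joined to each outer vertex
in one colour. -/
lemma adj_of_reachable {W : Finset V} {i t : K} {x x' z : V} (hz : z ∈ W)
    (hxx : (within (G i) W).Reachable x x') (hxz : ¬ (within (G i) W).Reachable x z)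
    (h : (G t).Adj x z) : (G t).Adj x' z := by
  have hx' := hxx
  rw [SimpleGraph.reachable_iff_reflTransGen] at hx'
  induction hx' with
  | refl => exact h
  | @tail u w hu huw ih =>
    have hu' : (within (G i) W).Reachable x u := by
      rwa [SimpleGraph.reachable_iff_reflTransGen]
    have hw' := hu'.trans huw.reachable
    have hut := ih hu'
    have huz : ¬ (G i).Adj u z := fun h =>
      hxz (hu'.trans (SimpleGraph.Adj.reachable ⟨h, huw.2.1, hz⟩))
    have hwz : ¬ (G i).Adj w z := fun h =>
      hxz (hw'.trans (SimpleGraph.Adj.reachable ⟨h, huw.2.2, hz⟩))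
    have hne : w ≠ z := fun h => hxz (h ▸ hw')
    obtain ⟨s, hs⟩ := hG.cover hne
    rcases hG.no_rainbow huw.1 hs hut with h | h | h
    · exact absurd (h ▸ hs) hwz
    · exact h ▸ hs
    · exact absurd (h ▸ hut) huz

/-- If colour `i` is disconnected on `W` but connected with `v` added, then an edge `v y` of another
colour `m` forces all edges leaving the component of `y` in `W` to have the colours `i` and `m`. -/
lemma disconn_insert {W : Finset V} {v : V} (hv : v ∉ W) {i j l : K} (hij : i ≠ j) (hil : i ≠ l)
    (hjl : j ≠ l) (hWi : Disconn (G i) W) :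
    Disconn (G i) (insert v W) ∨ Disconn (G j) (insert v W) ∨ Disconn (G l) (insert v W) := by
  classical
  by_cases hi : Disconn (G i) (insert v W)
  · exact Or.inl hi
  right
  have hne : ∀ {x}, x ∈ W → v ≠ x := fun hx h => hv (h ▸ hx)
  by_cases hall : ∀ y ∈ W, (G i).Adj v y
  · left
    obtain ⟨D, hDW, ⟨a, ha⟩, -, -⟩ := hWi
    refine ⟨{v}, by simp, by simp, ⟨a, ?_⟩, ?_⟩
    · simp [hDW ha, (hne (hDW ha)).symm]
    · intro x hx y hy hadj
      rw [Finset.mem_singleton] at hx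
      subst hx
      have hyW : y ∈ W := by
        have := Finset.mem_sdiff.1 hy
        exact (Finset.mem_insert.1 this.1).resolve_left (by simpa using this.2)
      exact hij (hG.unique (hall y hyW) hadj)
  push Not at hall
  obtain ⟨y, hyW, hy⟩ := hall
  obtain ⟨m, hm⟩ := hG.cover (hne hyW)
  have him : i ≠ m := fun h => hy (h ▸ hm)
  -- Each component of colour `i` contains a neighbour of `v` in this colour.
  have hnbr : ∀ z ∈ W, ∃ x ∈ W, (within (G i) W).Reachable z x ∧ (G i).Adj v x := by
    intro z hz
    by_contra! hno
    refine hi ⟨W.filter fun x => (within (G i) W).Reachable z x,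
      (Finset.filter_subset _ _).trans (Finset.subset_insert _ _),
      ⟨z, Finset.mem_filter.2 ⟨hz, Reachable.refl _⟩⟩, ⟨v, by simp [hv]⟩, ?_⟩
    intro x hx w hw hadj
    obtain ⟨hxW, hzx⟩ := Finset.mem_filter.1 hx
    obtain ⟨hw1, hw2⟩ := Finset.mem_sdiff.1 hw
    rcases Finset.mem_insert.1 hw1 with rfl | hwW
    · exact hno x hxW hzx hadj.symm
    · exact hw2 (Finset.mem_filter.2 ⟨hwW, hzx.trans (Adj.reachable ⟨hadj, hxW, hwW⟩)⟩)
  have key : ∀ x ∈ W, (within (G i) W).Reachable y x → ∀ z ∈ W,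
      ¬ (within (G i) W).Reachable y z → (G m).Adj x z := by
    intro x hxW hyx z hz hyz
    obtain ⟨u, huW, hzu, hvu⟩ := hnbr z hz
    have hyu : ¬ (within (G i) W).Reachable y u := fun h => hyz (h.trans hzu.symm)
    have hyune : y ≠ u := fun h => hyu (h ▸ Reachable.refl _)
    obtain ⟨s, hs⟩ := hG.cover hyune
    have hsm : s = m := by
      rcases hG.no_rainbow hm hs hvu with h | h | h
      · exact h.symm
      · have hs' : (within (G i) W).Adj y u := ⟨h ▸ hs, hyW, huW⟩
        exact absurd hs'.reachable hyu
      · exact absurd h.symm him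
    have h1 : (G m).Adj x u := hG.adj_of_reachable huW hyx hyu (hsm ▸ hs)
    exact (hG.adj_of_reachable hxW hzu.symm
      (fun h => hyu (hyx.trans h.symm)) h1.symm).symm
  obtain ⟨z, hzW, hyz⟩ := hWi.exists_not_reachable y
  obtain ⟨u, huW, hzu, hvu⟩ := hnbr z hzW
  have hyu : ¬ (within (G i) W).Reachable y u := fun h => hyz (h.trans hzu.symm)
  have hD : ∀ t, t ≠ i → t ≠ m → Disconn (G t) (insert v W) := by
    intro t hti htm
    refine ⟨W.filter fun x => (within (G i) W).Reachable y x,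
      (Finset.filter_subset _ _).trans (Finset.subset_insert _ _),
      ⟨y, Finset.mem_filter.2 ⟨hyW, Reachable.refl _⟩⟩, ⟨v, by simp [hv]⟩, ?_⟩
    intro x hx w hw hadj
    obtain ⟨hxW, hyx⟩ := Finset.mem_filter.1 hx
    obtain ⟨hw1, hw2⟩ := Finset.mem_sdiff.1 hw
    rcases Finset.mem_insert.1 hw1 with rfl | hwW
    · rcases hG.no_rainbow hadj hvu (key x hxW hyx u huW hyu) with h | h | h
      · exact hti h
      · exact him h
      · exact htm h
    · exact htm (hG.unique hadj (key x hxW hyx w hwW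
        fun h => hw2 (Finset.mem_filter.2 ⟨hwW, h⟩)))
  by_cases hjm : j = m
  · exact Or.inr (hD l hil.symm fun h => hjl (hjm.trans h.symm))
  · exact Or.inl (hD j hij.symm hjm)

/-- Of any three colours, one induces a disconnected graph. -/
theorem disconn_of_three {W : Finset V} (hW : 2 ≤ W.card) {i j l : K} (hij : i ≠ j) (hil : i ≠ l)
    (hjl : j ≠ l) : Disconn (G i) W ∨ Disconn (G j) W ∨ Disconn (G l) W := by
  induction W using Finset.induction_on with
  | empty => simp at hW
  | insert v W hv ih =>
    rw [Finset.card_insert_of_notMem hv] at hW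
    by_cases h1 : 2 ≤ W.card
    · rcases ih h1 with h | h | h
      · exact hG.disconn_insert hv hij hil hjl h
      · have := hG.disconn_insert hv hij.symm hjl hil h
        tauto
      · have := hG.disconn_insert hv hil.symm hjl.symm hij h
        tauto
    · obtain ⟨y, rfl⟩ := Finset.card_eq_one.1 (by omega : W.card = 1)
      have hvy : v ≠ y := by simpa using hv
      obtain ⟨m, hm⟩ := hG.cover hvy
      have hD : ∀ t, t ≠ m → Disconn (G t) {v, y} := by
        intro t ht
        refine ⟨{v}, by simp, by simp, ⟨y, by simp [hvy.symm]⟩, ?_⟩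
        intro x hx w hw hadj
        simp only [Finset.mem_singleton, Finset.mem_sdiff, Finset.mem_insert] at hx hw
        obtain rfl := hx
        obtain rfl := hw.1.resolve_left hw.2
        exact ht (hG.unique hadj hm)
      by_cases him : i = m
      · exact Or.inr (Or.inl (hD j fun h => hij (him.trans h.symm)))
      · exact Or.inl (hD i him)

/-- **Gallai's theorem**: the vertices can be partitioned, here into the fibres of `f`, into at
least two parts such that only two colours occur between the parts, and only one between any two
of them. -/
theorem exists_partition [DecidableEq K] {C : Finset K} (hC : 2 ≤ C.card) {W : Finset V}
    (hW : 2 ≤ W.card) (hWC : ∀ x ∈ W, ∀ y ∈ W, ∀ i, (G i).Adj x y → i ∈ C) :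
    ∃ r ∈ C, ∃ b ∈ C, r ≠ b ∧ ∃ f : V → V, (∃ x ∈ W, ∃ y ∈ W, f x ≠ f y) ∧
      ∀ x ∈ W, ∀ y ∈ W, f x ≠ f y → ((G r).Adj x y ∨ (G b).Adj x y) ∧
        ∀ x' ∈ W, f x' = f x → ∀ i, (G i).Adj x y → (G i).Adj x' y := by
  classical
  induction hc : W.card using Nat.strong_induction_on generalizing W with
  | _ N ih =>
  subst hc
  by_cases hex : ∃ i, (∃ x ∈ W, ∃ y ∈ W, (G i).Adj x y) ∧ Disconn (G i) W
  · -- Replace each component of colour `i` by a representative.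
    obtain ⟨i, ⟨x, hx, y, hy, hxy⟩, hi⟩ := hex
    set H := within (G i) W with hH
    let rep : V → V := fun v => (H.connectedComponentMk v).out
    have hrep : ∀ v, H.Reachable v (rep v) := fun v =>
      (ConnectedComponent.exact (Quot.out_eq (H.connectedComponentMk v))).symm
    have hrepW : ∀ v ∈ W, rep v ∈ W := fun v hv => mem_of_reachable_within hv (hrep v)
    have hrepeq : ∀ {u v}, H.Reachable u v → rep u = rep v := fun h => by
      simp only [rep, ConnectedComponent.sound h]
    have hsub : W.image rep ⊆ W := by
      intro u hu
      obtain ⟨v, hv, rfl⟩ := Finset.mem_image.1 hu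
      exact hrepW v hv
    have hlt : (W.image rep).card < W.card := by
      refine Finset.card_image_le.lt_of_ne fun h => ?_
      exact hxy.ne (Finset.card_image_iff.1 h hx hy (hrepeq (Adj.reachable ⟨hxy, hx, hy⟩)))
    have h2 : 2 ≤ (W.image rep).card := by
      obtain ⟨z, hz, hxz⟩ := hi.exists_not_reachable x
      refine Finset.one_lt_card.2 ⟨rep x, Finset.mem_image_of_mem _ hx, rep z,
        Finset.mem_image_of_mem _ hz, fun h => hxz ?_⟩
      exact (hrep x).trans (h ▸ (hrep z).symm)
    obtain ⟨r, hr, b, hb, hrb, f, ⟨p, hp, q, hq, hpq⟩, hf⟩ := ih _ hlt h2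
      (fun u hu v hv => hWC u (hsub hu) v (hsub hv)) rfl
    have htrans : ∀ u ∈ W, ∀ v ∈ W, rep u ≠ rep v → ∀ t, (G t).Adj u v ↔
        (G t).Adj (rep u) (rep v) := by
      intro u hu v hv huv t
      have h1 : ¬ H.Reachable u v := fun h => huv (hrepeq h)
      have h2 : ¬ H.Reachable v (rep u) := fun h => h1 ((hrep u).trans h.symm)
      have h3 : ¬ H.Reachable (rep u) (rep v) := fun h =>
        h1 ((hrep u).trans (h.trans (hrep v).symm))
      have h4 : ¬ H.Reachable (rep v) u := fun h => h1 (h.symm.trans (hrep v).symm)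
      constructor
      · intro h
        exact (hG.adj_of_reachable (hrepW u hu) (hrep v) h2
          (hG.adj_of_reachable hv (hrep u) h1 h).symm).symm
      · intro h
        exact (hG.adj_of_reachable hu (hrep v).symm h4
          (hG.adj_of_reachable (hrepW v hv) (hrep u).symm h3 h).symm).symm
    obtain ⟨p', hp', rfl⟩ := Finset.mem_image.1 hp
    obtain ⟨q', hq', rfl⟩ := Finset.mem_image.1 hq
    refine ⟨r, hr, b, hb, hrb, f ∘ rep, ⟨p', hp', q', hq', hpq⟩, ?_⟩
    intro u hu v hv huv
    have hne : ∀ {u v}, (f ∘ rep) u ≠ (f ∘ rep) v → rep u ≠ rep v := fun h h' => h (by simp [h'])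
    have himg : ∀ {v}, v ∈ W → rep v ∈ W.image rep := fun h => Finset.mem_image_of_mem _ h
    obtain ⟨h1, h2⟩ := hf (rep u) (himg hu) (rep v) (himg hv) huv
    refine ⟨h1.imp (htrans u hu v hv (hne huv) r).2 (htrans u hu v hv (hne huv) b).2, ?_⟩
    intro u' hu' huu' t ht
    have huv' : (f ∘ rep) u' ≠ (f ∘ rep) v := huu' ▸ huv
    rw [htrans u' hu' v hv (hne huv')]
    exact h2 _ (himg hu') huu' t ((htrans u hu v hv (hne huv) t).1 ht)
  · -- At most two colours occur, and the vertices may be taken as the parts.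
    push Not at hex
    set used := C.filter fun i => ∃ x ∈ W, ∃ y ∈ W, (G i).Adj x y with hused
    have h2 : used.card ≤ 2 := by
      by_contra! h3
      obtain ⟨i, j, l, hi, hj, hl, hij, hil, hjl⟩ := Finset.two_lt_card_iff.1 h3
      have hu : ∀ {t}, t ∈ used → ¬ Disconn (G t) W := fun ht => by
        obtain ⟨-, x, hx, y, hy, h⟩ := Finset.mem_filter.1 ht
        exact hex _ ⟨x, hx, y, hy, h⟩
      rcases hG.disconn_of_three hW hij hil hjl with h | h | h
      · exact hu hi h
      · exact hu hj h
      · exact hu hl h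
    obtain ⟨E, huE, hEC, hE⟩ := Finset.exists_subsuperset_card_eq (Finset.filter_subset _ C) h2 hC
    obtain ⟨r, b, hrb, rfl⟩ := Finset.card_eq_two.1 hE
    obtain ⟨x, hx, y, hy, hxy⟩ := Finset.one_lt_card.1 hW
    refine ⟨r, hEC (by simp), b, hEC (by simp), hrb, id, ⟨x, hx, y, hy, hxy⟩, ?_⟩
    intro u hu v hv huv
    refine ⟨?_, fun u' _ h i hi => by simp only [id] at h; rwa [h]⟩
    obtain ⟨i, hi⟩ := hG.cover huv
    have hiE := huE (Finset.mem_filter.2 ⟨hWC u hu v hv i hi, u, hu, v, hv, hi⟩)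
    rcases Finset.mem_insert.1 hiE with rfl | h
    · exact Or.inl hi
    · rw [Finset.mem_singleton] at h
      exact Or.inr (h ▸ hi)

end IsGallaiFamily

end

/-! ### The induction step for a large part -/

section

variable {V : Type*} [DecidableEq V]

/-- The set `X` is completely joined to `A` in `G`. -/
def Joined (G : SimpleGraph V) (X A : Finset V) : Prop := ∀ x ∈ X, ∀ y ∈ A, G.Adj x y

/-- The set `A` is independent in `G`. -/
def Indep (G : SimpleGraph V) (A : Finset V) : Prop := ∀ x ∈ A, ∀ y ∈ A, ¬ G.Adj x y

lemma Joined.disjoint {G : SimpleGraph V} {X A : Finset V} (h : Joined G X A) : Disjoint X A :=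
  Finset.disjoint_left.2 fun x hx hx' => (h x hx x hx').ne rfl

lemma Joined.symm {G : SimpleGraph V} {X A : Finset V} (h : Joined G X A) : Joined G A X :=
  fun x hx y hy => (h y hy x hx).symm

lemma Joined.union {G : SimpleGraph V} {X Y A : Finset V} (h : Joined G X A) (h' : Joined G Y A) :
    Joined G (X ∪ Y) A := fun x hx y hy =>
  (Finset.mem_union.1 hx).elim (fun hx => h x hx y hy) fun hx => h' x hx y hy

lemma Joined.mono {G : SimpleGraph V} {X A A' : Finset V} (h : Joined G X A) (hA : A' ⊆ A) :
    Joined G X A' := fun x hx y hy => h x hx y (hA hy)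

lemma Joined.indep {G : SimpleGraph V} {X A : Finset V} {n : ℕ} (h : Joined G X A) (hn : 1 ≤ n)
    (hA : n + 1 ≤ A.card) (hX : n ≤ X.card) (hno : ¬ HasCycle G (2 * n + 1)) : Indep G A :=
  fun _ hx _ hy hxy => hno (hasCycle_of_bip_edge hn h.symm.disjoint h.symm hA hX hx hy hxy)

/-- The situation in which `A` is a part of a Gallai partition of `W` with the two colours `R`
and `B`, and `P` and `Q` are the sets of vertices joined to `A` in `R` and in `B`. The sets `X`
and `Y` outside `W` are joined to `W` in `R` and in `B`. The last four fields are the induction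
hypotheses, where `s` is the number of vertices joined to `W` in the remaining colours. -/
structure PartData (R B : SimpleGraph V) (W A P Q X Y : Finset V) (n s M : ℕ) : Prop where
  two_le : 2 ≤ n
  two_mul_le : 2 * n ≤ M
  exclusive : ∀ {x y}, R.Adj x y → ¬ B.Adj x y
  noR : ¬ HasCycle R (2 * n + 1)
  noB : ¬ HasCycle B (2 * n + 1)
  subA : A ⊆ W
  subP : P ⊆ W
  subQ : Q ⊆ W
  card_eq : A.card + P.card + Q.card = W.card
  lt : A.card < W.card
  joinP : Joined R P A
  joinQ : Joined B Q A
  between : ∀ x ∈ P, ∀ y ∈ Q, R.Adj x y ∨ B.Adj x y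
  joinX : Joined R X W
  joinY : Joined B Y W
  cardX : X.card + 1 ≤ n
  cardY : Y.card + 1 ≤ n
  bound : ∀ A' ⊆ W, A'.card < W.card → ∀ X' Y', Joined R X' A' → Joined B Y' A' → X'.card ≤ n →
    Y'.card ≤ n → A'.card + X'.card + Y'.card + s ≤ 4 * M
  boundR : ∀ A' ⊆ W, Indep R A' → ∀ Y', Joined B Y' A' → Y'.card ≤ n →
    A'.card + Y'.card + s ≤ 2 * M
  boundB : ∀ A' ⊆ W, Indep B A' → ∀ X', Joined R X' A' → X'.card ≤ n →
    A'.card + X'.card + s ≤ 2 * M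
  boundRB : ∀ A' ⊆ W, Indep R A' → Indep B A' → A'.card + s ≤ M

namespace PartData

variable {R B : SimpleGraph V} {W A P Q X Y : Finset V} {n s M : ℕ}

lemma swap (h : PartData R B W A P Q X Y n s M) : PartData B R W A Q P Y X n s M where
  two_le := h.two_le
  two_mul_le := h.two_mul_le
  exclusive hB hR := h.exclusive hR hB
  noR := h.noB
  noB := h.noR
  subA := h.subA
  subP := h.subQ
  subQ := h.subP
  card_eq := by have := h.card_eq; omega
  lt := h.lt
  joinP := h.joinQ
  joinQ := h.joinP
  between x hx y hy := ((h.between y hy x hx).symm.imp Adj.symm Adj.symm)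
  joinX := h.joinY
  joinY := h.joinX
  cardX := h.cardY
  cardY := h.cardX
  bound A' hA hlt X' Y' hX hY hXn hYn := by
    have := h.bound A' hA hlt Y' X' hY hX hYn hXn
    omega
  boundR := h.boundB
  boundB := h.boundR
  boundRB A' hA hB hR := h.boundRB A' hA hR hB

variable (h : PartData R B W A P Q X Y n s M) (hA : n + 1 ≤ A.card)
include h

lemma card_XP : (X ∪ P).card = X.card + P.card :=
  Finset.card_union_of_disjoint (h.joinX.mono h.subP).disjoint

lemma join_XP : Joined R (X ∪ P) A := (h.joinX.mono h.subA).union h.joinP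

include hA

lemma indep_A (hP : n + 1 ≤ X.card + P.card) : Indep R A :=
  h.join_XP.indep (by have := h.two_le; omega) hA (by rw [h.card_XP]; omega) h.noR

lemma indep_P (hP : n + 1 ≤ P.card) : Indep R P :=
  h.joinP.symm.indep (by have := h.two_le; omega) hP (by omega) h.noR

lemma X_eq_empty (hP : n + 1 ≤ P.card) : X = ∅ := by
  by_contra hX
  obtain ⟨z, hz⟩ := Finset.nonempty_iff_ne_empty.2 hX
  obtain ⟨p, hp⟩ : P.Nonempty := Finset.card_pos.1 (by omega)
  obtain ⟨a, ha⟩ : A.Nonempty := Finset.card_pos.1 (by omega)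
  have hzW : z ∉ W := Finset.disjoint_left.1 h.joinX.disjoint hz
  exact h.noR (hasCycle_of_bip_apex h.two_le h.joinP.disjoint h.joinP (by omega) (by omega) hp ha
    (fun h' => hzW (h.subP h')) (fun h' => hzW (h.subA h')) (h.joinX z hz p (h.subP hp))
    (h.joinX z hz a (h.subA ha)))

lemma card_le_of_one (hP : n + 1 ≤ X.card + P.card) (hQ : Y.card + Q.card ≤ n) :
    W.card + X.card + Y.card + s ≤ 4 * M := by
  have h1 := h.boundR A h.subA (h.indep_A hA hP) (Y ∪ Q) h.swap.join_XP
    (by rw [h.swap.card_XP]; omega)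
  rw [h.swap.card_XP] at h1
  have h2 := h.card_eq
  have h3 := h.two_mul_le
  have h4 := h.cardX
  by_cases hP' : n + 1 ≤ P.card
  · have h5 := h.boundR P h.subP (h.indep_P hA hP') Y (h.joinY.mono h.subP) (by omega)
    rw [h.X_eq_empty hA hP', Finset.card_empty]
    omega
  · omega

/-- If two vertices of `Q` with `R`-neighbours in `P` are adjacent in `R`, then they have the same
single `R`-neighbour in `P`. -/
lemma eq_of_adj (hP : n + 1 ≤ P.card) {y y' p p' : V} (hy : y ∈ Q) (hy' : y' ∈ Q)
    (hyy : R.Adj y y') (hp : p ∈ P) (hp' : p' ∈ P) (hyp : R.Adj y p) (hyp' : R.Adj y' p') :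
    p = p' := by
  by_contra hpp
  have hdA : ∀ {z}, z ∈ Q → z ∉ A := fun hz => Finset.disjoint_left.1 h.joinQ.disjoint hz
  have hdP : ∀ {z}, z ∈ Q → z ∉ P := by
    intro z hz hzP
    obtain ⟨a, ha⟩ : A.Nonempty := Finset.card_pos.1 (by omega)
    exact h.exclusive (h.joinP z hzP a ha) (h.joinQ z hz a ha)
  exact h.noR (hasCycle_of_bip_outer_edge h.two_le h.joinP.symm.disjoint h.joinP.symm (by omega)
    (by omega) hp hp' hpp (hdA hy) (hdP hy) (hdA hy') (hdP hy') hyy hyp hyp')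

lemma card_le_of_indep (hP : n + 1 ≤ P.card) (hQ : n + 1 ≤ Q.card) {Q' Q'' : Finset V}
    (hQ' : Q' ⊆ Q) (hcard : Q'.card + Q''.card = Q.card) (hind : Indep R Q')
    (hjoin : Joined B Q'' P) : W.card + X.card + Y.card + s ≤ 4 * M := by
  have h1 := h.card_eq
  have h2 := h.boundRB A h.subA (h.indep_A hA (by omega)) (h.swap.indep_A hA (by omega))
  have h3 := h.boundRB Q' (hQ'.trans h.subQ) hind fun x hx y hy =>
    h.swap.indep_P hA hQ x (hQ' hx) y (hQ' hy)
  rw [h.X_eq_empty hA hP, h.swap.X_eq_empty hA hQ, Finset.card_empty]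
  by_cases hn : Q''.card ≤ n
  · have h4 := h.boundR P h.subP (h.indep_P hA hP) Q'' hjoin hn
    omega
  · have h4 := h.boundRB P h.subP (h.indep_P hA hP)
      (hjoin.indep (by have := h.two_le; omega) hP (by omega) h.noB)
    have h5 := h.boundB Q h.subQ (h.swap.indep_P hA hQ) ∅ (by simp [Joined]) (by simp)
    rw [Finset.card_empty] at h5
    omega

/-- The induction step in the presence of a part with more than `n` vertices. -/
theorem card_le : W.card + X.card + Y.card + s ≤ 4 * M := by
  classical
  have h1 := h.card_eq
  have h2 := h.two_mul_le
  have h3 := h.cardX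
  have h4 := h.cardY
  by_cases hP' : X.card + P.card ≤ n
  · by_cases hQ' : Y.card + Q.card ≤ n
    · have h5 := h.bound A h.subA h.lt (X ∪ P) (Y ∪ Q) h.join_XP h.swap.join_XP
        (by rw [h.card_XP]; omega) (by rw [h.swap.card_XP]; omega)
      rw [h.card_XP, h.swap.card_XP] at h5
      omega
    · have h5 := h.swap.card_le_of_one hA (by omega) hP'
      omega
  by_cases hQ' : Y.card + Q.card ≤ n
  · exact h.card_le_of_one hA (by omega) hQ'
  have h5 := h.boundRB A h.subA (h.indep_A hA (by omega)) (h.swap.indep_A hA (by omega))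
  by_cases hP : n + 1 ≤ P.card
  · by_cases hQ : n + 1 ≤ Q.card
    · set Q₁ := Q.filter fun y => ¬ ∀ x ∈ P, B.Adj y x with hQ₁
      set P₁ := P.filter fun x => ¬ ∀ y ∈ Q, R.Adj x y with hP₁
      have hcQ := Finset.card_filter_add_card_filter_not (s := Q) fun y => ∀ x ∈ P, B.Adj y x
      have hcP := Finset.card_filter_add_card_filter_not (s := P) fun x => ∀ y ∈ Q, R.Adj x y
      by_cases hi : Indep R Q₁
      · exact h.card_le_of_indep hA hP hQ (Finset.filter_subset _ _)
          ((add_comm _ _).trans hcQ) hi fun y hy x hx => (Finset.mem_filter.1 hy).2 x hx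
      by_cases hj : Indep B P₁
      · have := h.swap.card_le_of_indep hA hQ hP (Finset.filter_subset _ _)
          ((add_comm _ _).trans hcP) hj
          fun y hy x hx => (Finset.mem_filter.1 hy).2 x hx
        omega
      -- An `R`-edge `y₁ y₂` and a `B`-edge `x₁ x₂`: every `R`-edge at `y₁` or `y₂` leads to the
      -- same vertex of `P`, and every `B`-edge at `x₁` or `x₂` to the same vertex of `Q`.
      exfalso
      simp only [Indep] at hi hj
      push Not at hi hj
      obtain ⟨y₁, hy₁, y₂, hy₂, hyy⟩ := hi
      obtain ⟨x₁, hx₁, x₂, hx₂, hxx⟩ := hj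
      obtain ⟨hy₁Q, hy₁'⟩ := Finset.mem_filter.1 hy₁
      obtain ⟨hy₂Q, hy₂'⟩ := Finset.mem_filter.1 hy₂
      obtain ⟨hx₁P, hx₁'⟩ := Finset.mem_filter.1 hx₁
      obtain ⟨hx₂P, hx₂'⟩ := Finset.mem_filter.1 hx₂
      push Not at hy₁' hy₂' hx₁' hx₂'
      obtain ⟨p₁, hp₁, hp₁'⟩ := hy₁'
      obtain ⟨p₂, hp₂, hp₂'⟩ := hy₂'
      obtain ⟨q₁, hq₁, hq₁'⟩ := hx₁'
      obtain ⟨q₂, hq₂, hq₂'⟩ := hx₂'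
      have e₁ : R.Adj y₁ p₁ := ((h.between _ hp₁ _ hy₁Q).resolve_right fun h => hp₁' h.symm).symm
      have e₂ : R.Adj y₂ p₂ := ((h.between _ hp₂ _ hy₂Q).resolve_right fun h => hp₂' h.symm).symm
      have f₁ : B.Adj x₁ q₁ := (h.between _ hx₁P _ hq₁).resolve_left hq₁'
      have f₂ : B.Adj x₂ q₂ := (h.between _ hx₂P _ hq₂).resolve_left hq₂'
      have hpp := h.eq_of_adj hA hP hy₁Q hy₂Q hyy hp₁ hp₂ e₁ e₂
      have hqq := h.swap.eq_of_adj hA hQ hx₁P hx₂P hxx hq₁ hq₂ f₁ f₂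
      -- Both `y₁` and `y₂` are joined in `B` to a vertex of `P` other than `p₁ = p₂`.
      have key : ∀ x ∈ P, x ≠ p₁ → B.Adj x y₁ ∧ B.Adj x y₂ := by
        intro x hx hxp
        refine ⟨(h.between _ hx _ hy₁Q).resolve_left fun h' => hxp ?_,
          (h.between _ hx _ hy₂Q).resolve_left fun h' => hxp ?_⟩
        · rw [h.eq_of_adj hA hP hy₁Q hy₂Q hyy hx hp₂ h'.symm e₂, hpp]
        · rw [h.eq_of_adj hA hP hy₁Q hy₂Q hyy hp₁ hx e₁ h'.symm]
      by_cases hx : x₁ = p₁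
      · obtain ⟨k₁, k₂⟩ := key x₂ hx₂P fun h => hxx.ne (hx.trans h.symm)
        have g₁ := h.swap.eq_of_adj hA hQ hx₁P hx₂P hxx hq₁ hy₁Q f₁ k₁
        have g₂ := h.swap.eq_of_adj hA hQ hx₁P hx₂P hxx hq₁ hy₂Q f₁ k₂
        exact hyy.ne (g₁.symm.trans g₂)
      · obtain ⟨k₁, k₂⟩ := key x₁ hx₁P hx
        have g₁ := h.swap.eq_of_adj hA hQ hx₁P hx₂P hxx hy₁Q hq₂ k₁ f₂
        have g₂ := h.swap.eq_of_adj hA hQ hx₁P hx₂P hxx hy₂Q hq₂ k₂ f₂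
        exact hyy.ne (g₁.trans g₂.symm)
    · have h6 := h.boundR P h.subP (h.indep_P hA hP) Y (h.joinY.mono h.subP) (by omega)
      rw [h.X_eq_empty hA hP, Finset.card_empty]
      omega
  · by_cases hQ : n + 1 ≤ Q.card
    · have h6 := h.boundB Q h.subQ (h.swap.indep_P hA hQ) X (h.joinX.mono h.subQ) (by omega)
      rw [h.swap.X_eq_empty hA hQ, Finset.card_empty]
      omega
    · omega

end PartData

end

/-! ### The induction step for small parts -/

section

variable {V : Type*} [DecidableEq V] {G : SimpleGraph V}

/-- Every path of `G` inside `S` has at most `q` vertices. -/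
def PathBound (G : SimpleGraph V) (S : Finset V) (q : ℕ) : Prop :=
  ∀ a b l, IsPathFrom G a b l → (∀ x ∈ l, x ∈ S) → l.length ≤ q

lemma PathBound.mono {S : Finset V} {q q' : ℕ} (h : PathBound G S q) (hq : q ≤ q') :
    PathBound G S q' := fun a b l hl hS => (h a b l hl hS).trans hq

lemma PathBound.degree_eq_zero [DecidableRel G.Adj] {S : Finset V} (h : PathBound G S 1) {x : V}
    (hx : x ∈ S) : (S.filter (G.Adj x)).card = 0 := by
  rw [Finset.card_eq_zero, Finset.filter_eq_empty_iff]
  intro y hy hxy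
  have := h x y [x, y] ⟨by simp [hxy.ne], by simp [hxy], by simp, by simp⟩ (by simp [hx, hy])
  simp at this

lemma PathBound.degree_le_one [DecidableRel G.Adj] {S : Finset V} (h : PathBound G S 2) {x : V}
    (hx : x ∈ S) : (S.filter (G.Adj x)).card ≤ 1 := by
  rw [Finset.card_le_one]
  intro y hy z hz
  by_contra hyz
  obtain ⟨hyS, hxy⟩ := Finset.mem_filter.1 hy
  obtain ⟨hzS, hxz⟩ := Finset.mem_filter.1 hz
  have := h y z [y, x, z] ⟨by simp [hxy.ne', hxz.ne, hyz], by simp [hxy.symm, hxz], by simp,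
    by simp⟩ (by simp [hx, hyS, hzS])
  simp at this

/-- If the vertices of degree at least `d` have pairwise disjoint neighbourhoods of some kind with
at least `e` elements each, then there are few of them. -/
lemma exists_subset_degree_lt [DecidableRel G.Adj] (S : Finset V) (d e : ℕ) (F : V → Finset V)
    (hFS : ∀ x ∈ S, F x ⊆ S)
    (hF : ∀ x ∈ S, d ≤ (S.filter (G.Adj x)).card → e ≤ (F x).card)
    (hdis : ∀ x ∈ S, d ≤ (S.filter (G.Adj x)).card → ∀ y ∈ S, d ≤ (S.filter (G.Adj y)).card →
      x ≠ y → Disjoint (F x) (F y)) :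
    ∃ S' ⊆ S, e * S.card ≤ S.card + e * S'.card ∧
      ∀ x ∈ S', (S'.filter (G.Adj x)).card < d := by
  set T := S.filter fun x => d ≤ (S.filter (G.Adj x)).card with hT
  refine ⟨S \ T, Finset.sdiff_subset, ?_, ?_⟩
  · have h1 : T.card * e ≤ (T.biUnion F).card := by
      rw [Finset.card_biUnion]
      · rw [← smul_eq_mul]
        exact Finset.card_nsmul_le_sum _ _ _ fun x hx =>
          hF x (Finset.mem_filter.1 hx).1 (Finset.mem_filter.1 hx).2
      · intro x hx y hy hxy
        exact hdis x (Finset.mem_filter.1 hx).1 (Finset.mem_filter.1 hx).2 y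
          (Finset.mem_filter.1 hy).1 (Finset.mem_filter.1 hy).2 hxy
    have h2 : (T.biUnion F).card ≤ S.card := Finset.card_le_card
      (Finset.biUnion_subset.2 fun x hx => hFS x (Finset.mem_filter.1 hx).1)
    have h3 := Finset.card_sdiff_add_card_eq_card (Finset.filter_subset _ _ : T ⊆ S)
    rw [← hT] at h3
    have h4 : e * S.card = e * (S \ T).card + T.card * e := by rw [← h3]; ring
    omega
  · intro x hx
    obtain ⟨hxS, hxT⟩ := Finset.mem_sdiff.1 hx
    by_contra! hd
    exact hxT (Finset.mem_filter.2 ⟨hxS, hd.trans (Finset.card_le_card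
      (Finset.filter_subset_filter _ Finset.sdiff_subset))⟩)

lemma exists_adj_notMem [DecidableRel G.Adj] {S : Finset V} {x : V} {D : Finset V}
    (h : D.card < (S.filter (G.Adj x)).card) : ∃ y ∈ S, G.Adj x y ∧ y ∉ D := by
  obtain ⟨y, hy, hyD⟩ := Finset.exists_mem_notMem_of_card_lt_card h
  exact ⟨y, (Finset.mem_filter.1 hy).1, (Finset.mem_filter.1 hy).2, hyD⟩

/-- Without paths on four vertices, the closed neighbourhoods of the vertices of degree
at least three are disjoint. -/
lemma PathBound.exists_subset_of_three [DecidableRel G.Adj] {S : Finset V} (h : PathBound G S 3)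
    {d : ℕ} (hd : 3 ≤ d) : ∃ S' ⊆ S, (d + 1) * S.card ≤ S.card + (d + 1) * S'.card ∧
      ∀ x ∈ S', (S'.filter (G.Adj x)).card < d := by
  have hadj : ∀ x ∈ S, d ≤ (S.filter (G.Adj x)).card → ∀ y ∈ S, d ≤ (S.filter (G.Adj y)).card →
      ¬ G.Adj x y := by
    intro x hx hxd y hy hyd hxy
    obtain ⟨u, hu, hxu, huy⟩ := exists_adj_notMem (G := G) (S := S) (x := x) (D := {y})
      (by simp; omega)
    obtain ⟨w, hw, hyw, hwx⟩ := exists_adj_notMem (G := G) (S := S) (x := y) (D := {x, u})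
      (Finset.card_le_two.trans_lt (by omega))
    simp only [Finset.mem_singleton, Finset.mem_insert, not_or] at huy hwx
    have := h u w [u, x, y, w]
      ⟨by simp [hxu.ne', huy, hxy.ne, Ne.symm hwx.1, Ne.symm hwx.2, hyw.ne],
        by simp [hxu.symm, hxy, hyw], by simp, by simp⟩ (by simp [hx, hy, hu, hw])
    simp at this
  refine exists_subset_degree_lt S d (d + 1) (fun x => insert x (S.filter (G.Adj x)))
    (fun x hx => Finset.insert_subset hx (Finset.filter_subset _ _)) ?_ ?_
  · intro x _ hxd
    rw [Finset.card_insert_of_notMem (by simp)]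
    omega
  · intro x hx hxd y hy hyd hxy
    rw [Finset.disjoint_left]
    intro z hz hz'
    rcases Finset.mem_insert.1 hz with rfl | hz
    · rcases Finset.mem_insert.1 hz' with h' | hz'
      · exact hxy h'
      · exact hadj y hy hyd z hx hxd (Finset.mem_filter.1 hz').2
    obtain ⟨hzS, hxz⟩ := Finset.mem_filter.1 hz
    rcases Finset.mem_insert.1 hz' with rfl | hz'
    · exact hadj x hx hxd z hy hyd hxz
    have hyz := (Finset.mem_filter.1 hz').2
    obtain ⟨u, hu, hxu, huD⟩ := exists_adj_notMem (G := G) (S := S) (x := x) (D := {z, y})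
      (Finset.card_le_two.trans_lt (by omega))
    simp only [Finset.mem_singleton, Finset.mem_insert, not_or] at huD
    have := h u y [u, x, z, y]
      ⟨by simp [hxu.ne', huD, hxy, hxz.ne, hyz.ne'],
        by simp [hxu.symm, hxz, hyz.symm], by simp, by simp⟩ (by simp [hx, hy, hu, hzS])
    simp at this

/-- Without paths on five vertices, the neighbourhoods of the vertices of degree at least four are
disjoint. -/
lemma PathBound.exists_subset_of_four [DecidableRel G.Adj] {S : Finset V} (h : PathBound G S 4)
    {d : ℕ} (hd : 4 ≤ d) : ∃ S' ⊆ S, d * S.card ≤ S.card + d * S'.card ∧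
      ∀ x ∈ S', (S'.filter (G.Adj x)).card < d := by
  refine exists_subset_degree_lt S d d (fun x => S.filter (G.Adj x))
    (fun x hx => Finset.filter_subset _ _) (fun _ _ h => h) ?_
  intro x hx hxd y hy hyd hxy
  rw [Finset.disjoint_left]
  intro z hz hz'
  obtain ⟨hzS, hxz⟩ := Finset.mem_filter.1 hz
  have hyz := (Finset.mem_filter.1 hz').2
  obtain ⟨u, hu, hxu, huD⟩ := exists_adj_notMem (G := G) (S := S) (x := x) (D := {z, y})
    (Finset.card_le_two.trans_lt (by omega))
  obtain ⟨w, hw, hyw, hwD⟩ := exists_adj_notMem (G := G) (S := S) (x := y) (D := {z, x, u})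
    (Finset.card_le_three.trans_lt (by omega))
  simp only [Finset.mem_singleton, Finset.mem_insert, not_or] at huD hwD
  have := h u w [u, x, z, y, w]
    ⟨by simp [hxu.ne', huD, hxy, hxz.ne, hyz.ne', hyw.ne, Ne.symm hwD.1, Ne.symm hwD.2.1,
      Ne.symm hwD.2.2], by simp [hxu.symm, hxz, hyz.symm, hyw], by simp, by simp⟩
    (by simp [hx, hy, hu, hw, hzS])
  simp at this

/-- If two disjoint paths in `U` never have more than `2δ + 2` vertices together, then the maximum
degree is at most `δ` on a large part of `U`, obtained by removing a longest path or
the vertices of large degree. -/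
lemma exists_subset_degree_le [DecidableRel G.Adj] {U : Finset V} {δ N : ℕ} (hδ : δ ≤ 3)
    (hN : 2 ≤ N) (hN' : N ≤ 11) (hU : N + 2 * δ + 1 ≤ U.card)
    (hno : ∀ a b l c d l', IsPathFrom G a b l → IsPathFrom G c d l' → (∀ x ∈ l, x ∈ U) →
      (∀ x ∈ l', x ∈ U) → l.Disjoint l' → l.length + l'.length ≤ 2 * δ + 2) :
    ∃ S ⊆ U, N ≤ S.card ∧ ∀ x ∈ S, (S.filter (G.Adj x)).card ≤ δ := by
  obtain ⟨a, b, l, hl, hlU, hmax⟩ := exists_longest_path G (S := U) (Finset.card_pos.1 (by omega))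
  -- A longer path could be cut to `2δ + 2` vertices, leaving a further vertex as a second path.
  have hq : l.length ≤ 2 * δ + 1 := by
    by_contra! hq
    obtain ⟨b', ht⟩ := hl.take (k := 2 * δ + 2) (by omega) (by omega)
    have htc : (l.take (2 * δ + 2)).toFinset.card < U.card :=
      (List.toFinset_card_le _).trans_lt (by rw [List.length_take]; omega)
    obtain ⟨z, hz, hzl⟩ := Finset.exists_mem_notMem_of_card_lt_card htc
    rw [List.mem_toFinset] at hzl
    have := hno _ _ _ _ _ _ ht (IsPathFrom.single z) (fun x hx => hlU x (List.mem_of_mem_take hx))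
      (by simpa using hz) (by simpa [List.disjoint_singleton] using hzl)
    simp only [List.length_take, List.length_singleton] at this
    omega
  have hUb : PathBound G U l.length := hmax
  have hc : (U \ l.toFinset).card + l.length = U.card := by
    rw [← List.toFinset_card_of_nodup hl.nodup]
    exact Finset.card_sdiff_add_card_eq_card fun x hx => hlU x (List.mem_toFinset.1 hx)
  have hsub : U \ l.toFinset ⊆ U := Finset.sdiff_subset
  have hrest : PathBound G (U \ l.toFinset) (2 * δ + 2 - l.length) := by
    intro c d l' hl' hl'U
    have := hno _ _ _ _ _ _ hl hl' hlU (fun x hx => hsub (hl'U x hx)) (fun x hx hx' =>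
      (Finset.mem_sdiff.1 (hl'U x hx')).2 (List.mem_toFinset.2 hx))
    omega
  have hpos := hl.length_pos
  -- Outside a longest path with `q` vertices, the paths have at most `2δ + 2 - q` vertices.
  by_cases h0 : 2 * δ + 1 = l.length
  · exact ⟨_, hsub, by omega, fun x hx => by
      rw [(hrest.mono (by omega)).degree_eq_zero hx]; omega⟩
  have hδ0 : δ ≠ 0 := by omega
  by_cases h1 : 2 * δ ≤ l.length
  · exact ⟨_, hsub, by omega, fun x hx =>
      ((hrest.mono (by omega)).degree_le_one hx).trans (by omega)⟩
  by_cases hδ1 : δ = 1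
  · exact ⟨U, subset_rfl, by omega, fun x hx => by
      rw [(hUb.mono (by omega)).degree_eq_zero hx]; omega⟩
  obtain rfl | rfl : δ = 2 ∨ δ = 3 := by omega
  · obtain ⟨S, hS, h2, h3⟩ := (hUb.mono (by omega)).exists_subset_of_three (le_refl 3)
    exact ⟨S, hS, by omega, fun x hx => Nat.le_of_lt_succ (h3 x hx)⟩
  · by_cases h5 : l.length = 5
    · obtain ⟨S, hS, h2, h3⟩ := (hrest.mono (by omega)).exists_subset_of_three (d := 4) (by omega)
      exact ⟨S, hS.trans hsub, by omega, fun x hx => Nat.le_of_lt_succ (h3 x hx)⟩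
    · obtain ⟨S, hS, h2, h3⟩ := (hUb.mono (by omega)).exists_subset_of_four (le_refl 4)
      exact ⟨S, hS, by omega, fun x hx => Nat.le_of_lt_succ (h3 x hx)⟩

/-- The induction step when the parts have at most `α` vertices: the set `U` is joined in `R` to
`α` further vertices, and any two vertices in different parts of `U`, the fibres of `f`,
are adjacent in `R` or in `B`. -/
theorem hasCycle_of_small_parts {R B : SimpleGraph V} {A U : Finset V} {n α : ℕ} (f : V → V)
    (hα : 2 ≤ α) (hαn : α ≤ n) (hnα : n ≤ α + 3) (hn : n ≤ 5) (hA : Joined R A U)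
    (hAc : α ≤ A.card) (hU : 4 * n + 2 ≤ U.card + 2 * α)
    (hcov : ∀ x ∈ U, ∀ y ∈ U, f x ≠ f y → R.Adj x y ∨ B.Adj x y)
    (hf : ∀ x ∈ U, (U.filter fun y => f y = f x).card ≤ α) :
    HasCycle R (2 * n + 1) ∨ HasCycle B (2 * n + 1) := by
  classical
  by_cases hR : HasCycle R (2 * n + 1)
  · exact Or.inl hR
  right
  obtain ⟨S, hSU, hS, hdeg⟩ := exists_subset_degree_le (G := R) (U := U) (δ := n - α)
    (N := 2 * n + 1) (by omega) (by omega) (by omega) (by omega) (by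
      intro a b l c d l' hl hl' hlU hl'U hll
      by_contra! hlen
      exact hR (hasCycle_of_two_paths hα hαn hA.disjoint hA hAc (by omega) hl hl' hlU hl'U hll
        (by omega)))
  refine hasCycle_of_few_nonadj (by omega) hS fun x hx => ?_
  refine ⟨S.filter (R.Adj x) ∪ (U.filter fun y => f y = f x).erase x, ?_, ?_⟩
  · have h1 := Finset.card_union_le (S.filter (R.Adj x)) ((U.filter fun y => f y = f x).erase x)
    have h2 := hdeg x hx
    have h3 := hf x (hSU hx)
    have h4 := Finset.card_erase_of_mem (s := U.filter fun y => f y = f x) (a := x)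
      (Finset.mem_filter.2 ⟨hSU hx, rfl⟩)
    omega
  · intro y hy hyx hyD
    simp only [Finset.mem_union, Finset.mem_filter, Finset.mem_erase, not_or, not_and] at hyD
    exact (hcov x (hSU hx) y (hSU hy) fun h => hyD.2 hyx (hSU hy) h.symm).resolve_left (hyD.1 hy)

end

/-! ### The upper bound -/

section

variable {V : Type*} [DecidableEq V] {K : Type*} [DecidableEq K]

/-- All edges of the coloured complete graph on `W` have their colours in `C`. -/
def ColorsIn (G : K → SimpleGraph V) (C : Finset K) (W : Finset V) : Prop :=
  ∀ x ∈ W, ∀ y ∈ W, ∀ i, (G i).Adj x y → i ∈ C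

/-- The statement of the main induction: if the edges inside `W` have their colours in `C`, and
for each colour `i ∈ C` there is a set `X i` of at most `n` vertices joined to `W` in colour `i`,
then there are at most `n * 2 ^ #C` vertices altogether. -/
def Bounded (G : K → SimpleGraph V) (n : ℕ) (C : Finset K) (W : Finset V) : Prop :=
  ColorsIn G C W → ∀ X : K → Finset V, (∀ i ∈ C, Joined (G i) (X i) W) →
    (∀ i ∈ C, (X i).card ≤ n) → W.card + ∑ i ∈ C, (X i).card ≤ n * 2 ^ C.card

lemma ColorsIn.mono {G : K → SimpleGraph V} {C : Finset K} {W W' : Finset V} (h : ColorsIn G C W)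
    (hW : W' ⊆ W) : ColorsIn G C W' := fun x hx y hy => h x (hW hx) y (hW hy)

lemma ColorsIn.erase {G : K → SimpleGraph V} {C : Finset K} {W : Finset V} (h : ColorsIn G C W)
    {i : K} (hi : Indep (G i) W) : ColorsIn G (C.erase i) W := fun x hx y hy j hj =>
  Finset.mem_erase.2 ⟨fun hji => hi x hx y hy (hji ▸ hj), h x hx y hy j hj⟩

/-- A clique `W` with fewer than `n` further vertices `X` joined to it. -/
lemma hasCycle_of_clique {G : SimpleGraph V} {W X : Finset V} {n : ℕ} (hn : 1 ≤ n)
    (hW : ∀ x ∈ W, ∀ y ∈ W, x ≠ y → G.Adj x y) (hX : Joined G X W) (hXn : X.card + 1 ≤ n)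
    (hcard : 2 * n + 1 ≤ W.card + X.card) : HasCycle G (2 * n + 1) := by
  have hc : (W ∪ X).card = W.card + X.card := Finset.card_union_of_disjoint hX.disjoint.symm
  refine hasCycle_of_few_nonadj (U := W ∪ X) hn (by omega) fun x hx => ?_
  by_cases hxW : x ∈ W
  · refine ⟨∅, by simpa using hn, fun y hy hyx _ => ?_⟩
    rcases Finset.mem_union.1 hy with hy | hy
    · exact hW x hxW y hy hyx.symm
    · exact (hX y hy x hxW).symm
  · refine ⟨X, hXn, fun y hy _ hyX => ?_⟩
    exact hX x ((Finset.mem_union.1 hx).resolve_left hxW) y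
      ((Finset.mem_union.1 hy).resolve_right hyX)

/-- The induction step when the largest part `A` of the Gallai partition, whose parts are
the fibres of `f`, has at most `n` vertices, and `P` together with `X` is at least as large as the
set of vertices joined to `A` in the colour `B`. -/
lemma hasCycle_of_small_largest_part {R B : SimpleGraph V} {A P X : Finset V} {n : ℕ} (f : V → V)
    (hn : n = 4 ∨ n = 5) (hA : 2 ≤ A.card) (hAn : A.card ≤ n) (hX : X.card + 1 ≤ n)
    (hAP : Joined R A P) (hXP : Joined R X P) (hAX : Disjoint A X)
    (hcard : 7 * n + 2 ≤ A.card + 2 * (P.card + X.card))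
    (hcov : ∀ x ∈ P, ∀ y ∈ P, f x ≠ f y → R.Adj x y ∨ B.Adj x y)
    (hf : ∀ x ∈ P, (P.filter fun y => f y = f x).card ≤ A.card) :
    HasCycle R (2 * n + 1) ∨ HasCycle B (2 * n + 1) := by
  have hc : (A ∪ X).card = A.card + X.card := Finset.card_union_of_disjoint hAX
  -- At least `min n (#A + #X)` vertices are joined to `P`, and parts have at most `#A` vertices.
  refine hasCycle_of_small_parts (α := min n (A.card + X.card)) f (by omega) (by omega) (by omega)
    (by omega) (hAP.union hXP) (by omega) (by omega) hcov fun x hx => (hf x hx).trans (by omega)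

lemma add_four_le_two_pow (t : ℕ) : t + 4 ≤ 2 ^ (t + 2) := by
  have := Nat.lt_two_pow_self (n := t)
  rw [pow_add]
  omega

namespace IsGallaiFamily

variable {G : K → SimpleGraph V} (hG : IsGallaiFamily G)
include hG

lemma disjoint_of_joined {X Y W : Finset V} {i j : K} (hW : W.Nonempty) (hij : i ≠ j)
    (hX : Joined (G i) X W) (hY : Joined (G j) Y W) : Disjoint X Y := by
  obtain ⟨w, hw⟩ := hW
  exact Finset.disjoint_left.2 fun x hx hx' => hij (hG.unique (hX x hx w hw) (hY x hx' w hw))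

/-- The induction step when only two colours occur in `W`. -/
lemma card_le_of_two_colors {n : ℕ} (hn : 2 ≤ n) (hno : ∀ i, ¬ HasCycle (G i) (2 * n + 1))
    {W : Finset V} (hW : W.Nonempty) {r b : K} (hrb : r ≠ b)
    (hcov : ∀ x ∈ W, ∀ y ∈ W, x ≠ y → (G r).Adj x y ∨ (G b).Adj x y) {X Y : Finset V}
    (hX : Joined (G r) X W) (hY : Joined (G b) Y W) (hXn : X.card + 1 ≤ n)
    (hYn : Y.card + 1 ≤ n) : W.card + X.card + Y.card ≤ 4 * n := by
  by_contra! h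
  rcases hasCycle_of_two_colors hn hcov hX hY hX.disjoint.symm hY.disjoint.symm
    (hG.disjoint_of_joined hW hrb hX hY) hXn hYn h with h | h
  · exact hno r h
  · exact hno b h

/-- The induction step for a Gallai partition of `W`, given by the fibres of `f`, some of which
have more than one element. -/
lemma card_le_of_partition {n : ℕ} (hn : n = 4 ∨ n = 5)
    (hno : ∀ i, ¬ HasCycle (G i) (2 * n + 1)) {C : Finset K} {W : Finset V} (hC : 3 ≤ C.card)
    (hin : ColorsIn G C W) (ihC : ∀ C' : Finset K, C'.card < C.card → ∀ W', Bounded G n C' W')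
    (ihW : ∀ W' : Finset V, W'.card < W.card → Bounded G n C W') (X : K → Finset V)
    (hX : ∀ i ∈ C, Joined (G i) (X i) W) (hXn : ∀ i ∈ C, (X i).card + 1 ≤ n) {r b : K}
    (hr : r ∈ C) (hb : b ∈ C) (hrb : r ≠ b) {f : V → V} (hf : ∃ x ∈ W, ∃ y ∈ W, f x ≠ f y)
    (hpart : ∀ x ∈ W, ∀ y ∈ W, f x ≠ f y → ((G r).Adj x y ∨ (G b).Adj x y) ∧
      ∀ x' ∈ W, f x' = f x → ∀ i, (G i).Adj x y → (G i).Adj x' y)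
    (hninj : ∃ x ∈ W, ∃ y ∈ W, x ≠ y ∧ f x = f y) :
    W.card + ∑ i ∈ C, (X i).card ≤ n * 2 ^ C.card := by
  classical
  have hbr : b ∈ C.erase r := Finset.mem_erase.2 ⟨hrb.symm, hb⟩
  set D := (C.erase r).erase b with hD
  have hDC : D ⊆ C := (Finset.erase_subset _ _).trans (Finset.erase_subset _ _)
  have hcr : (C.erase r).card = C.card - 1 := Finset.card_erase_of_mem hr
  have hcb : (C.erase b).card = C.card - 1 := Finset.card_erase_of_mem hb
  have hcD : D.card = C.card - 2 := by rw [hD, Finset.card_erase_of_mem hbr, hcr]; omega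
  have hD' : (C.erase b).erase r = D := Finset.erase_right_comm
  set s := ∑ i ∈ D, (X i).card with hs
  obtain ⟨t, ht⟩ : ∃ t, C.card = t + 3 := ⟨C.card - 3, by omega⟩
  have hM : n * 2 ^ C.card = 4 * (n * 2 ^ (t + 1)) := by rw [ht]; ring
  have hM1 : n * 2 ^ (C.card - 1) = 2 * (n * 2 ^ (t + 1)) := by
    rw [ht, show t + 3 - 1 = t + 2 from rfl]; ring
  have hM2 : n * 2 ^ (C.card - 2) = n * 2 ^ (t + 1) := by rw [ht]; rfl
  -- Sums over `C` are split into the contributions of `r`, of `b` and of the rest.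
  have hsumr : ∀ Z : K → Finset V, ∑ i ∈ C.erase r, (Z i).card =
      (Z b).card + ∑ i ∈ D, (Z i).card := fun Z =>
    (Finset.add_sum_erase _ (fun i => (Z i).card) hbr).symm
  have hsumb : ∀ Z : K → Finset V, ∑ i ∈ C.erase b, (Z i).card =
      (Z r).card + ∑ i ∈ D, (Z i).card := fun Z => by
    rw [← hD']
    exact (Finset.add_sum_erase _ (fun i => (Z i).card) (Finset.mem_erase.2 ⟨hrb, hr⟩)).symm
  have hsum : ∀ Z : K → Finset V, ∑ i ∈ C, (Z i).card =
      (Z r).card + ((Z b).card + ∑ i ∈ D, (Z i).card) := fun Z => by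
    rw [← hsumr]
    exact (Finset.add_sum_erase _ (fun i => (Z i).card) hr).symm
  obtain ⟨p, hpW, hpmax⟩ := Finset.exists_max_image W (fun x => (W.filter fun y => f y = f x).card)
    (by obtain ⟨x, hx, -⟩ := hf; exact ⟨x, hx⟩)
  set A := W.filter fun y => f y = f p with hA
  set P := W.filter fun y => f p ≠ f y ∧ (G r).Adj p y with hP
  set Q := W.filter fun y => f p ≠ f y ∧ (G b).Adj p y with hQ
  have hAW : A ⊆ W := Finset.filter_subset _ _
  have hPW : P ⊆ W := Finset.filter_subset _ _
  have hQW : Q ⊆ W := Finset.filter_subset _ _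
  have hA2 : 2 ≤ A.card := by
    obtain ⟨x, hx, y, hy, hxy, hfxy⟩ := hninj
    refine le_trans ?_ (hpmax x hx)
    exact Finset.one_lt_card.2 ⟨x, by simp [hx], y, by simp [hy, hfxy], hxy⟩
  have hAlt : A.card < W.card := by
    refine Finset.card_lt_card (Finset.filter_ssubset.2 ?_)
    obtain ⟨x, hx, y, hy, hxy⟩ := hf
    by_cases h : f x = f p
    · exact ⟨y, hy, fun h' => hxy (h.trans h'.symm)⟩
    · exact ⟨x, hx, h⟩
  have hPA : Joined (G r) P A := fun y hy a ha => by
    obtain ⟨hyW, hpy, h⟩ := Finset.mem_filter.1 hy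
    obtain ⟨haW, hap⟩ := Finset.mem_filter.1 ha
    exact ((hpart p hpW y hyW hpy).2 a haW hap r h).symm
  have hQA : Joined (G b) Q A := fun y hy a ha => by
    obtain ⟨hyW, hpy, h⟩ := Finset.mem_filter.1 hy
    obtain ⟨haW, hap⟩ := Finset.mem_filter.1 ha
    exact ((hpart p hpW y hyW hpy).2 a haW hap b h).symm
  have hPQ : Disjoint P Q := Finset.disjoint_left.2 fun y hy hy' =>
    hrb (hG.unique (Finset.mem_filter.1 hy).2.2 (Finset.mem_filter.1 hy').2.2)
  have hcardW : A.card + P.card + Q.card = W.card := by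
    have h1 : P ∪ Q = W.filter fun y => ¬ f y = f p := by
      ext y
      simp only [hP, hQ, Finset.mem_union, Finset.mem_filter]
      constructor
      · rintro (⟨h1, h2, -⟩ | ⟨h1, h2, -⟩) <;> exact ⟨h1, Ne.symm h2⟩
      · rintro ⟨h1, h2⟩
        have := (hpart p hpW y h1 (Ne.symm h2)).1
        have h3 := Ne.symm h2
        tauto
    have h2 := Finset.card_filter_add_card_filter_not (s := W) fun y => f y = f p
    rw [← h1, Finset.card_union_of_disjoint hPQ, ← hA] at h2
    omega
  have hXr := hXn r hr
  have hXb := hXn b hb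
  rw [hsum X, hM]
  by_cases hAn : n + 1 ≤ A.card
  · have hpd : PartData (G r) (G b) W A P Q (X r) (X b) n s (n * 2 ^ (t + 1)) :=
      { two_le := by omega
        two_mul_le := by
          rw [mul_comm]
          exact Nat.mul_le_mul_left n (by have := Nat.one_le_two_pow (n := t); rw [pow_succ]; omega)
        exclusive := fun h h' => hrb (hG.unique h h')
        noR := hno r
        noB := hno b
        subA := hAW
        subP := hPW
        subQ := hQW
        card_eq := hcardW
        lt := hAlt
        joinP := hPA
        joinQ := hQA
        between := by
          intro x hx y hy
          obtain ⟨hxW, hpx, hx'⟩ := Finset.mem_filter.1 hx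
          obtain ⟨hyW, hpy, hy'⟩ := Finset.mem_filter.1 hy
          refine (hpart x hxW y hyW fun hxy => ?_).1
          -- A common part would be joined to `p` in both colours.
          have := (hpart x hxW p hpW (Ne.symm hpx)).2 y hyW hxy.symm r hx'.symm
          exact hrb (hG.unique this hy'.symm)
        joinX := hX r hr
        joinY := hX b hb
        cardX := hXr
        cardY := hXb
        bound := by
          intro A' hA' hlt X' Y' hX' hY' hXn' hYn'
          let Z : K → Finset V := fun i => if i = r then X' else if i = b then Y' else X i
          have h1 := ihW A' hlt (hin.mono hA') Z ?_ ?_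
          · have hZD : ∑ i ∈ D, (Z i).card = s := Finset.sum_congr rfl fun i hi => by
              have h2 := Finset.mem_erase.1 hi
              have h3 := Finset.mem_erase.1 h2.2
              simp only [Z, if_neg h2.1, if_neg h3.1]
            have hZr : Z r = X' := if_pos rfl
            have hZb : Z b = Y' := by simp [Z, hrb.symm]
            rw [hsum Z, hZD, hZr, hZb, hM] at h1
            omega
          · intro i hi
            by_cases h1 : i = r
            · subst h1; simpa [Z] using hX'
            by_cases h2 : i = b
            · subst h2; simpa [Z, h1] using hY'
            simpa [Z, h1, h2] using (hX i hi).mono hA'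
          · intro i hi
            by_cases h1 : i = r
            · subst h1; simpa [Z] using hXn'
            by_cases h2 : i = b
            · subst h2; simpa [Z, h1] using hYn'
            have := hXn i hi
            simp only [Z, h1, h2, if_false]
            omega
        boundR := by
          intro A' hA' hind Y' hY' hYn'
          let Z : K → Finset V := fun i => if i = b then Y' else X i
          have h1 := ihC (C.erase r) (by omega) A' ((hin.mono hA').erase hind) Z ?_ ?_
          · have hZD : ∑ i ∈ D, (Z i).card = s := Finset.sum_congr rfl fun i hi => by
              simp only [Z, if_neg (Finset.mem_erase.1 hi).1]
            have hZb : Z b = Y' := if_pos rfl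
            rw [hsumr Z, hZD, hZb, hcr, hM1] at h1
            omega
          · intro i hi
            by_cases h2 : i = b
            · subst h2; simpa [Z] using hY'
            simpa [Z, h2] using (hX i (Finset.mem_of_mem_erase hi)).mono hA'
          · intro i hi
            by_cases h2 : i = b
            · subst h2; simpa [Z] using hYn'
            have := hXn i (Finset.mem_of_mem_erase hi)
            simp only [Z, h2, if_false]
            omega
        boundB := by
          intro A' hA' hind X' hX' hXn'
          let Z : K → Finset V := fun i => if i = r then X' else X i
          have h1 := ihC (C.erase b) (by omega) A' ((hin.mono hA').erase hind) Z ?_ ?_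
          · have hZD : ∑ i ∈ D, (Z i).card = s := Finset.sum_congr rfl fun i hi => by
              simp only [Z, if_neg (Finset.mem_erase.1 (Finset.mem_of_mem_erase hi)).1]
            have hZr : Z r = X' := if_pos rfl
            rw [hsumb Z, hZD, hZr, hcb, hM1] at h1
            omega
          · intro i hi
            by_cases h2 : i = r
            · subst h2; simpa [Z] using hX'
            simpa [Z, h2] using (hX i (Finset.mem_of_mem_erase hi)).mono hA'
          · intro i hi
            by_cases h2 : i = r
            · subst h2; simpa [Z] using hXn'
            have := hXn i (Finset.mem_of_mem_erase hi)
            simp only [Z, h2, if_false]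
            omega
        boundRB := by
          intro A' hA' hindr hindb
          have h1 := ihC D (by omega) A' (((hin.mono hA').erase hindr).erase hindb) X
            (fun i hi => (hX i (hDC hi)).mono hA') fun i hi => by have := hXn i (hDC hi); omega
          rwa [hcD, hM2] at h1 }
    have := hpd.card_le hAn
    omega
  · by_contra! hbig
    have hsle : s ≤ (t + 1) * (n - 1) := by
      have := Finset.sum_le_card_nsmul D (fun i => (X i).card) (n - 1) fun i hi => by
        have := hXn i (hDC hi); omega
      rw [smul_eq_mul, hcD, ht] at this
      exact this
    -- The sets joined to `W` in colours other than `r` and `b` have fewer than `n` vertices each,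
    -- and the worst case is that of three colours, with `8 * n + 1 - (n - 1)` vertices left.
    have htotal : 7 * n + 2 ≤ W.card + (X r).card + (X b).card := by
      have h1 : t + 1 ≤ 2 ^ t := Nat.lt_two_pow_self
      have h2 : n * 2 ^ (t + 1) = 2 * (n * 2 ^ t) := by ring
      have h3 : n * (t + 1) ≤ n * 2 ^ t := Nat.mul_le_mul_left n h1
      rcases hn with rfl | rfl <;> omega
    have hWne : A.Nonempty := Finset.card_pos.1 (by omega)
    have hdisj : ∀ i ∈ C, Disjoint A (X i) := fun i hi =>
      (Finset.disjoint_of_subset_right hAW (hX i hi).disjoint).symm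
    have hcov : ∀ x ∈ W, ∀ y ∈ W, f x ≠ f y → (G r).Adj x y ∨ (G b).Adj x y :=
      fun x hx y hy h => (hpart x hx y hy h).1
    have hfib : ∀ U ⊆ W, ∀ x ∈ U, (U.filter fun y => f y = f x).card ≤ A.card :=
      fun U hU x hx => (Finset.card_le_card (Finset.filter_subset_filter _ hU)).trans
        (hpmax x (hU hx))
    by_cases hle : Q.card + (X b).card ≤ P.card + (X r).card
    · rcases hasCycle_of_small_largest_part (B := G b) f hn hA2 (by omega) hXr hPA.symm
        ((hX r hr).mono hPW) (hdisj r hr) (by omega)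
        (fun x hx y hy h => hcov x (hPW hx) y (hPW hy) h) (hfib P hPW) with h | h
      · exact hno r h
      · exact hno b h
    · rcases hasCycle_of_small_largest_part (B := G r) f hn hA2 (by omega) hXb hQA.symm
        ((hX b hb).mono hQW) (hdisj b hb) (by omega)
        (fun x hx y hy h => (hcov x (hQW hx) y (hQW hy) h).symm) (hfib Q hQW) with h | h
      · exact hno b h
      · exact hno r h

/-- The bound on the number of vertices in the absence of monochromatic cycles on `2 * n + 1`
vertices. -/
theorem bounded {n : ℕ} (hn : n = 4 ∨ n = 5) (hno : ∀ i, ¬ HasCycle (G i) (2 * n + 1))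
    (C : Finset K) (W : Finset V) : Bounded G n C W := by
  classical
  induction hk : C.card using Nat.strong_induction_on generalizing C W with
  | _ k ihC =>
  induction hw : W.card using Nat.strong_induction_on generalizing W with
  | _ w ihW =>
  subst hk hw
  intro hin X hX hXn
  by_cases hWn : W.card ≤ n
  · have h1 := Finset.sum_le_card_nsmul C (fun i => (X i).card) n hXn
    have h2 : n * (C.card + 1) ≤ n * 2 ^ C.card := Nat.mul_le_mul_left n Nat.lt_two_pow_self
    rw [smul_eq_mul, mul_comm] at h1
    rw [mul_add, mul_one] at h2
    omega
  by_cases hfull : ∃ i ∈ C, (X i).card = n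
  · -- The colour `i` does not occur in `W`.
    obtain ⟨i, hi, hXi⟩ := hfull
    have hind := (hX i hi).indep (by omega) (by omega) hXi.ge (hno i)
    have h1 := ihC _ (Finset.card_erase_lt_of_mem hi) _ W rfl (hin.erase hind) X
      (fun j hj => hX j (Finset.mem_of_mem_erase hj)) fun j hj => hXn j (Finset.mem_of_mem_erase hj)
    have h2 := Finset.add_sum_erase _ (fun j => (X j).card) hi
    have h3 := Finset.card_erase_add_one hi
    have h4 := Nat.one_le_two_pow (n := (C.erase i).card)
    have h5 : n * 1 ≤ n * 2 ^ (C.erase i).card := Nat.mul_le_mul_left n h4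
    rw [hXi] at h2
    rw [← h3, pow_succ, ← mul_assoc]
    omega
  have hXn' : ∀ i ∈ C, (X i).card + 1 ≤ n := fun i hi =>
    Nat.lt_of_le_of_ne (hXn i hi) fun h => hfull ⟨i, hi, h⟩
  obtain ⟨x₀, hx₀, y₀, hy₀, hxy₀⟩ := Finset.one_lt_card.1 (by omega : 1 < W.card)
  obtain ⟨i₀, hi₀⟩ := hG.cover hxy₀
  have hi₀C := hin x₀ hx₀ y₀ hy₀ i₀ hi₀
  have hpos : 0 < C.card := Finset.card_pos.2 ⟨i₀, hi₀C⟩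
  by_cases hC1 : C.card = 1
  · obtain ⟨i, rfl⟩ := Finset.card_eq_one.1 hC1
    rw [hC1, Finset.sum_singleton]
    by_contra! hbig
    refine hno i (hasCycle_of_clique (by omega) (fun x hx y hy hxy => ?_) (hX i (by simp))
      (hXn' i (by simp)) (by omega))
    obtain ⟨j, hj⟩ := hG.cover hxy
    have := hin x hx y hy j hj
    rw [Finset.mem_singleton] at this
    exact this ▸ hj
  obtain ⟨r, hr, b, hb, hrb, f, hf, hpart⟩ :=
    hG.exists_partition (by omega : 2 ≤ C.card) (by omega : 2 ≤ W.card) hin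
  by_cases htwo : ∀ x ∈ W, ∀ y ∈ W, x ≠ y → (G r).Adj x y ∨ (G b).Adj x y
  · have h1 := hG.card_le_of_two_colors (by omega) hno ⟨x₀, hx₀⟩ hrb htwo (hX r hr) (hX b hb)
      (hXn' r hr) (hXn' b hb)
    have hbr : b ∈ C.erase r := Finset.mem_erase.2 ⟨hrb.symm, hb⟩
    have h2 := Finset.add_sum_erase _ (fun j => (X j).card) hr
    have h3 := Finset.add_sum_erase _ (fun j => (X j).card) hbr
    have h4 := Finset.sum_le_card_nsmul ((C.erase r).erase b) (fun i => (X i).card) n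
      fun i hi => hXn i (Finset.mem_of_mem_erase (Finset.mem_of_mem_erase hi))
    rw [smul_eq_mul, Finset.card_erase_of_mem hbr, Finset.card_erase_of_mem hr] at h4
    obtain ⟨t, ht⟩ : ∃ t, C.card = t + 2 := ⟨C.card - 2, by omega⟩
    have h5 : n * (t + 4) ≤ n * 2 ^ (t + 2) := Nat.mul_le_mul_left n (add_four_le_two_pow t)
    rw [ht] at h4 ⊢
    have h6 : (t + 2 - 1 - 1) * n = n * t := by rw [mul_comm]; rfl
    rw [h6] at h4
    rw [mul_add] at h5
    omega
  · have hninj : ∃ x ∈ W, ∃ y ∈ W, x ≠ y ∧ f x = f y := by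
      by_contra! hinj
      exact htwo fun x hx y hy hxy => (hpart x hx y hy (hinj x hx y hy hxy)).1
    have hC3 : 3 ≤ C.card := by
      by_contra! hC2
      refine htwo fun x hx y hy hxy => ?_
      obtain ⟨i, hi⟩ := hG.cover hxy
      have hCeq : {r, b} = C := Finset.eq_of_subset_of_card_le (by
        intro j hj
        rcases Finset.mem_insert.1 hj with rfl | hj
        · exact hr
        · rwa [Finset.mem_singleton.1 hj]) (by rw [Finset.card_pair hrb]; omega)
      have := hin x hx y hy i hi
      rw [← hCeq, Finset.mem_insert, Finset.mem_singleton] at this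
      rcases this with rfl | rfl
      · exact Or.inl hi
      · exact Or.inr hi
    exact hG.card_le_of_partition hn hno hC3 hin (fun C' hC' W' => ihC _ hC' C' W' rfl)
      (fun W' hW' => ihW _ hW' W' rfl) X hX hXn' hr hb hrb hf hpart hninj

end IsGallaiFamily

end

/-! ### The lower bound -/

/-- The least level `j` at which `x` and `y` lie in the same block, when the natural numbers are
cut into blocks of `m * 2 ^ j` consecutive numbers. For `m ≥ 1` there is such a level. -/
noncomputable def level (m x y : ℕ) : ℕ := sInf {j | x / (m * 2 ^ j) = y / (m * 2 ^ j)}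

lemma level_comm (m x y : ℕ) : level m x y = level m y x := by
  simp only [level, eq_comm]

lemma level_le_iff {m : ℕ} (hm : 1 ≤ m) {x y j : ℕ} :
    level m x y ≤ j ↔ x / (m * 2 ^ j) = y / (m * 2 ^ j) := by
  have hne : {j | x / (m * 2 ^ j) = y / (m * 2 ^ j)}.Nonempty := by
    refine ⟨x + y, ?_⟩
    have h1 : x + y < m * 2 ^ (x + y) :=
      Nat.lt_two_pow_self.trans_le (Nat.le_mul_of_pos_left _ hm)
    rw [Set.mem_ofPred_eq, Nat.div_eq_of_lt (by omega), Nat.div_eq_of_lt (by omega)]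
  refine ⟨fun h => ?_, fun h => Nat.sInf_le h⟩
  obtain ⟨d, hd⟩ := Nat.exists_eq_add_of_le h
  have h1 : x / (m * 2 ^ level m x y) = y / (m * 2 ^ level m x y) := Nat.sInf_mem hne
  rw [hd, pow_add, ← mul_assoc, ← Nat.div_div_eq_div_mul, h1, Nat.div_div_eq_div_mul]

/-- The level is an ultrametric. -/
lemma level_le_max {m : ℕ} (hm : 1 ≤ m) (x y z : ℕ) :
    level m x z ≤ max (level m x y) (level m y z) := by
  rw [level_le_iff hm]
  exact ((level_le_iff hm).1 (le_max_left _ _)).trans ((level_le_iff hm).1 (le_max_right _ _))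

lemma level_le_of_lt {m k x y : ℕ} (hm : 1 ≤ m) (hx : x < m * 2 ^ k) (hy : y < m * 2 ^ k) :
    level m x y ≤ k := by
  rw [level_le_iff hm, Nat.div_eq_of_lt hx, Nat.div_eq_of_lt hy]

/-- The edges of a fixed positive level form a bipartite graph. -/
lemma parity_ne_of_level {m x y s : ℕ} (hm : 1 ≤ m) (h : level m x y = s + 1) :
    x / (m * 2 ^ s) % 2 ≠ y / (m * 2 ^ s) % 2 := by
  intro hpar
  have h1 := (level_le_iff hm).1 h.le
  rw [pow_succ, ← mul_assoc, ← Nat.div_div_eq_div_mul x, ← Nat.div_div_eq_div_mul y] at h1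
  have h2 : level m x y ≤ s := (level_le_iff hm).2 (by omega)
  omega

/-- The colouring of the complete graph by levels. -/
noncomputable def levelLabeling (m : ℕ) {N k : ℕ} (hm : 1 ≤ m) (hN : N ≤ m * 2 ^ k) :
    TopEdgeLabeling (Fin N) (Fin (k + 1)) :=
  EdgeLabeling.mk (fun x y _ => ⟨level m x y, Nat.lt_succ_of_le
    (level_le_of_lt hm (x.2.trans_le hN) (y.2.trans_le hN))⟩)
    fun x y _ => Fin.ext (level_comm m y x)

lemma levelLabeling_adj {m N k : ℕ} (hm : 1 ≤ m) (hN : N ≤ m * 2 ^ k) {i : Fin (k + 1)}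
    {x y : Fin N} (h : ((levelLabeling m hm hN).labelGraph i).Adj x y) : level m x y = i := by
  rw [TopEdgeLabeling.labelGraph_adj] at h
  obtain ⟨hxy, h⟩ := h
  rw [levelLabeling, EdgeLabeling.get_mk] at h
  exact congrArg Fin.val h

lemma isGallaiColoring_levelLabeling {m N k : ℕ} (hm : 1 ≤ m) (hN : N ≤ m * 2 ^ k) :
    IsGallaiColoring (levelLabeling m hm hN) := by
  intro x y z hxy hyz hxz
  simp only [levelLabeling, EdgeLabeling.get_mk, ne_eq, Fin.mk.injEq]
  have h1 := level_le_max hm x y z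
  have h2 := level_le_max hm x z y
  have h3 := level_le_max hm y x z
  rw [level_comm m z y] at h2
  rw [level_comm m y x] at h3
  omega

/-- In the colouring by levels, colour `0` has components with at most `m` vertices, and the other
colours are bipartite. -/
lemma not_hasMonochromaticCopy_levelLabeling {n N k : ℕ} (hn : 1 ≤ n)
    (hm : 1 ≤ 2 * n) (hN : N ≤ 2 * n * 2 ^ k) :
    ¬ HasMonochromaticCopy (cycleGraph (2 * n + 1)) (levelLabeling (2 * n) hm hN) := by
  rintro ⟨⟨i, hi⟩, ⟨φ⟩⟩
  have hadj : ∀ {u v}, (cycleGraph (2 * n + 1)).Adj u v → level (2 * n) (φ u) (φ v) = i :=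
    fun h => levelLabeling_adj hm hN (φ.toHom.map_adj h)
  rcases i with - | s
  · have hblock : ∀ v, (φ v : ℕ) / (2 * n) = (φ 0 : ℕ) / (2 * n) := by
      intro v
      have := (SimpleGraph.cycleGraph_preconnected (n := 2 * n + 1)) 0 v
      rw [SimpleGraph.reachable_iff_reflTransGen] at this
      induction this with
      | refl => rfl
      | tail _ h ih =>
        have := (level_le_iff hm).1 (hadj h).le
        rw [pow_zero, mul_one] at this
        exact this.symm.trans ih
    have hinj : Function.Injective fun v =>
        (⟨(φ v : ℕ) % (2 * n), Nat.mod_lt _ hm⟩ : Fin (2 * n)) := by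
      intro u v huv
      have h1 : (φ u : ℕ) % (2 * n) = (φ v : ℕ) % (2 * n) := congrArg Fin.val huv
      have h2 : (φ u : ℕ) = φ v := by
        rw [← Nat.div_add_mod (φ u : ℕ) (2 * n), ← Nat.div_add_mod (φ v : ℕ) (2 * n), h1,
          hblock u, hblock v]
      exact φ.injective (Fin.ext h2)
    have := Fintype.card_le_of_injective _ hinj
    simp at this
  · have hcol : (cycleGraph (2 * n + 1)).Colorable 2 := ⟨Coloring.mk
      (fun v => (⟨(φ v : ℕ) / (2 * n * 2 ^ s) % 2, Nat.mod_lt _ two_pos⟩ : Fin 2))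
      fun h h' => parity_ne_of_level hm (hadj h) (congrArg Fin.val h')⟩
    have h1 := hcol.chromaticNumber_le
    rw [chromaticNumber_cycleGraph_of_odd _ (by omega) ⟨n, rfl⟩] at h1
    exact absurd h1 (by decide)

/-- The colour classes of a Gallai colouring. -/
lemma isGallaiFamily_labelGraph {V K : Type*} [DecidableEq V] {c : TopEdgeLabeling V K}
    (hc : IsGallaiColoring c) : IsGallaiFamily fun i => c.labelGraph i where
  cover {x y} h := ⟨c.get x y h, (TopEdgeLabeling.labelGraph_adj _ _).2 ⟨h, rfl⟩⟩
  unique h h' := by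
    obtain ⟨h1, rfl⟩ := (TopEdgeLabeling.labelGraph_adj _ _).1 h
    obtain ⟨h2, rfl⟩ := (TopEdgeLabeling.labelGraph_adj _ _).1 h'
    rfl
  no_rainbow h h' h'' := by
    obtain ⟨h1, rfl⟩ := (TopEdgeLabeling.labelGraph_adj _ _).1 h
    obtain ⟨h2, rfl⟩ := (TopEdgeLabeling.labelGraph_adj _ _).1 h'
    obtain ⟨h3, rfl⟩ := (TopEdgeLabeling.labelGraph_adj _ _).1 h''
    have := hc _ _ _ h1 h2 h3
    tauto

end GallaiOddCycle

theorem theorem1p9 (n : ℕ) (hn : n = 4 ∨ n = 5) (k : ℕ) (hk : 1 ≤ k) :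
    IsGallaiRamseyNumber k (cycleGraph (2 * n + 1)) (n * 2 ^ k + 1) := by
  constructor
  · intro c hc
    by_contra hno
    have h := (GallaiOddCycle.isGallaiFamily_labelGraph hc).bounded hn
      (fun i hi => hno ⟨i, hi.isContained (by omega)⟩) Finset.univ Finset.univ
      (fun _ _ _ _ i _ => Finset.mem_univ i) (fun _ => ∅) (fun _ _ _ hx => by simp at hx)
      (fun _ _ => by simp)
    simp at h
  · intro N hN
    by_contra! hlt
    obtain ⟨k, rfl⟩ : ∃ l, k = l + 1 := ⟨k - 1, by omega⟩
    have hm : 1 ≤ 2 * n := by omega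
    have hN' : N ≤ 2 * n * 2 ^ k := by
      rw [pow_succ] at hlt
      have h : n * (2 ^ k * 2) = 2 * n * 2 ^ k := by ring
      omega
    exact GallaiOddCycle.not_hasMonochromaticCopy_levelLabeling (by omega) hm hN'
      (hN _ (GallaiOddCycle.isGallaiColoring_levelLabeling hm hN'))
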